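/- **Setting.** An episodic MDP has $H$ stages, levels $1,\dots,k$ in each stage, and $A$ actions. In state $(l,i)$ (level $l$, stage $i$), playing action $a$ produces a random non-negative reward together with a level in stage $i+1$, drawn from a joint law that depends only on $(l,i,a)$; $p_i(s\mid l,a)$ is the probability that the next level is $s$. An additional level $0$ is allowed as a successor and means that the episode terminates without further reward. An episode starts in $(k,1)$, and its total reward is almost surely at most $1$ under every policy. For a deterministic policy $\pi=(\pi_{l,i})$ let $V(\pi)$ be its expected total reward, and let $\mathrm{Opt}=\max_\pi V(\pi)$. Under *bandit feedback*, a learner plays policies $\pi^1,\dots,\pi^T$, one per episode, and after each episode observes only the total reward of that episode; its expected regret is $\mathbb E\sum_{t=1}^T(\mathrm{Opt}-V(\pi^t))$. The MDP is *ordered* with respect to total orders $\prec_{l,i}$ on the actions if (i) $p_i(s\mid l,a)=0$ for all $i$, $a$ and $s>l$, and (ii) $p_i(l\mid l,a)\le p_i(l\mid l,b)$ for all $(l,i)$ and all $a\prec_{l,i}b$. **Algorithm.** The learner knows $H,k,A,T$ and the orders $\prec_{l,i}$, but neither the transition probabilities nor the reward laws. It maintains non-empty active sets $A_{l,i}$ of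 actions, initially all actions, and an accuracy $\epsilon$, initially $1$. While $\epsilon>\sqrt{HkA\log T/T}$ it runs a phase, then replaces $A_{l,i}$ by the set $N_{l,i}$ computed in the phase and halves $\epsilon$. A phase processes the states $(l,i)$ for $i=H,\dots,1$ and, within a stage, for $l=k,\dots,1$. For every $a\in A_{l,i}$ it computes the average reward $\hat\Phi_{l,i}(a)$ of $\lceil 12\log T/\epsilon^2\rceil$ episodes, in each of which it plays a freshly drawn policy: the policy plays $a$ in $(l,i)$, it plays the actions $\hat\alpha_{s,j}$ already computed in this phase in the states of stages $j>i$, and in every other state $(s,j)$ with $j\le i$ it independently plays a uniformly random action of $A_{s,j}$ with probability $\frac{k}{2H}$ and the $\prec_{s,j}$-maximal action of $A_{s,j}$ with probability $1-\frac{k}{2H}$. Then $\hat\alpha_{l,i}$ is a maximizer of $\hat\Phi_{l,i}$ over $A_{l,i}$, and $$N_{l,i}=\{a\in A_{l,i}:\hat\Phi_{l,i}(a)\ge\hat\Phi_{l,i}(\hat\alpha_{l,i})-C_{l,i}\,\epsilon\},\qquad C_{l,i}=e^{(H-i)k/H}\Big(\frac{2AH}{k}\Big)^{l-1}(H-i+1)^l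 .$$ After the last phase a policy that uses active actions only is played for the remaining episodes. The procedure is cut off after $T$ episodes. **Theorem.** There is a universal constant $K>0$ such that for all $1\le k\le H$, $A\ge1$, $T\ge2$ and all total orders $\prec_{l,i}$, this algorithm is a measurable function of the history, and on every MDP that is ordered with respect to $\prec_{l,i}$ its expected regret over $T$ episodes is at most $$K\Big(\frac{2eH^2A}{k}\Big)^{k}\sqrt{\frac{k^3H}{A}\,T\log T}.$$ Moreover, the following problems with independent data for $i=1,\dots,H$ are ordered MDPs with $H$ stages and $k$ levels. In each case it is assumed that the total reward of an execution is almost surely at most $1$ under every policy; the level is the remaining capacity, with the execution ending at capacity $0$; the MDP below satisfies all of the above requirements; and the total reward of every policy has the same law in the MDP as in the direct execution of the problem. 1. *$k$-item prophet inequality*: values $X_i\ge0$, thresholds $\tau_{i,1}\le\dots\le\tau_{i,A}$ (for example the support of $X_i$). Action $a$ at item $i$ selects the item, with reward $X_i$, and decreases the capacity by one if $X_i>\tau_{i,a}$; otherwise nothing happens. The actions are ordered by their indices. 2. *Sequential posted pricing*: valuations $X_i$, prices $0\le p_{i,1}\le\dots\le p_{i,A}$. Action $a$ offers customer $i$ the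 price $p_{i,a}$; if $X_i\ge p_{i,a}$, the reward is $p_{i,a}$ and the capacity decreases by one; otherwise nothing happens. The actions are ordered by their indices. 3. *Stochastic knapsack with a fixed item order*: items with (possibly correlated) reward $R_i\ge0$ and integer cost $C_i\ge0$, and $A=2$ actions, ordered by accept $\prec$ reject. With remaining budget $l$, accepting item $i$ gives reward $R_i$ and leaves budget $l-C_i$ if $C_i\le l$, and otherwise gives no reward and ends the execution; rejecting keeps the budget. -/

import Mathlib

open MeasureTheory

namespace BanditMDP

noncomputable section

/-! ### Episodic MDPs -/

/-- An episodic MDP with `H` stages, `k` levels per stage and `A` actions.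
Stage `i : Fin H` stands for stage `i + 1` and level `l : Fin k` for level `l + 1`.
Successor levels live in `Fin (k + 1)`, where level `l : Fin k` appears as `l.succ`; the additional
value `0` means that the episode terminates (with no further reward). An MDP all of whose transitions
stay in `{1, …, k}` never uses it.
`step i l a` is the joint law of the (random) reward collected in state `(l, i)` under action `a` and
of the level in the next stage; reward and successor may be correlated. -/
structure EpisodicMDP (H k A : ℕ) where
  step : Fin H → Fin k → Fin A → Measure (ℝ × Fin (k + 1))
  isProbabilityMeasure_step : ∀ i l a, IsProbabilityMeasure (step i l a)

/-- Deterministic policies: `π i l` is the action played in level `l` of stage `i`. -/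
abbrev Policy (H k A : ℕ) : Type := Fin H → Fin k → Fin A

namespace EpisodicMDP

variable {H k A : ℕ}

/-- The transition probability `p_i(s ∣ l, a)`. -/
def transProb (M : EpisodicMDP H k A) (i : Fin H) (l : Fin k) (a : Fin A) (s : Fin (k + 1)) : ℝ :=
  (M.step i l a).real {z | z.2 = s}

/-- The law of the total reward collected by `π` in the last `n` stages, started in level `s`.
The first of these stages is `Fin.rev n`, i.e. the one with (zero-based) index `H - 1 - (n - 1)`. -/
def tailLaw (M : EpisodicMDP H k A) (π : Policy H k A) :
    (n : ℕ) → n ≤ H → Fin (k + 1) → Measure ℝ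
  | 0, _, _ => Measure.dirac 0
  | n + 1, h, s =>
    Fin.cases (motive := fun _ => Measure ℝ) (Measure.dirac 0)
      (fun l =>
        (M.step (Fin.rev ⟨n, h⟩) l (π (Fin.rev ⟨n, h⟩) l)).bind fun z =>
          (tailLaw M π n (Nat.le_of_succ_le h) z.2).map fun x => z.1 + x) s

/-- The law of the cumulative reward of one episode under `π`, started in level `k` of stage `1`. -/
def rewardLaw (M : EpisodicMDP H k A) (π : Policy H k A) : Measure ℝ :=
  M.tailLaw π H le_rfl (Fin.last k)

/-- The value `V(π)`: the expected cumulative reward of one episode. -/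
def value (M : EpisodicMDP H k A) (π : Policy H k A) : ℝ := ∫ x, x ∂(M.rewardLaw π)

/-- The optimal value. -/
def opt (M : EpisodicMDP H k A) : ℝ := ⨆ π : Policy H k A, M.value π

/-- Rewards are non-negative and the total reward of an episode is at most one. -/
def IsNormalized (M : EpisodicMDP H k A) : Prop :=
  (∀ i l a, ∀ᵐ z ∂(M.step i l a), 0 ≤ z.1) ∧ ∀ π, ∀ᵐ x ∂(M.rewardLaw π), x ≤ 1

/-- Ordered MDPs, with respect to total orders `ord i l` on the actions: levels never increase, and
the probability of staying in the current level is monotone in the action. -/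
def IsOrdered (M : EpisodicMDP H k A) (ord : Fin H → Fin k → LinearOrder (Fin A)) : Prop :=
  (∀ i l a s, l.succ < s → M.transProb i l a s = 0) ∧
    ∀ i l a b, (ord i l).lt a b → M.transProb i l a l.succ ≤ M.transProb i l b l.succ

end EpisodicMDP

/-! ### Online algorithms with bandit feedback and their regret -/

/-- An online algorithm with bandit feedback: from the policies played in the past episodes
and the cumulative rewards of those episodes (in chronological order), it chooses the distribution of
the policy played in the next episode. -/
abbrev OnlineAlgorithm (H k A : ℕ) : Type := List (Policy H k A × ℝ) → PMF (Policy H k A)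

/-- The choice of an online algorithm is a measurable function of the history. -/
def OnlineAlgorithm.IsMeasurable {H k A : ℕ} (alg : OnlineAlgorithm H k A) : Prop :=
  ∀ (t : ℕ) (π : Policy H k A),
    Measurable fun h : Fin t → Policy H k A × ℝ => alg (List.ofFn h) π

/-- The expected cumulative regret `𝔼 ∑ (Opt - V(π^t))` of an algorithm over a number of
episodes, as an iterated integral: the first policy `π` is drawn from the algorithm, the feedback `x`
is drawn from the law of the cumulative reward of `π`, and the algorithm continues with `(π, x)`
recorded in its history. -/
def EpisodicMDP.expectedRegret {H k A : ℕ} (M : EpisodicMDP H k A) :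
    ℕ → OnlineAlgorithm H k A → ENNReal
  | 0, _ => 0
  | T + 1, alg =>
    ∑ π : Policy H k A, alg [] π *
      (ENNReal.ofReal (M.opt - M.value π) +
        ∫⁻ x, M.expectedRegret T (fun h => alg ((π, x) :: h)) ∂(M.rewardLaw π))

/-- Programs that interact with the environment only by playing a policy drawn from a given
distribution for one episode and reading off its cumulative reward. -/
inductive BanditProg (P : Type) (α : Type) : Type
  | ret (a : α) : BanditProg P α
  | play (μ : PMF P) (next : ℝ → BanditProg P α) : BanditProg P α

namespace BanditProg

/-- Sequential composition. -/
def bind {P α β : Type} : BanditProg P α → (α → BanditProg P β) → BanditProg P β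
  | ret a, f => f a
  | play μ next, f => play μ fun x => (next x).bind f

/-- The online algorithm that follows a program and, once the program has returned a policy,
plays this policy in all remaining episodes. -/
def act {P : Type} : BanditProg P P → List (P × ℝ) → PMF P
  | ret π, _ => PMF.pure π
  | play μ _, [] => μ
  | play _ next, (_, x) :: h => (next x).act h

/-- Play `n` episodes with independent policies drawn from `μ`, and add the rewards to `acc`. -/
def sumRewards {P : Type} (μ : PMF P) : ℕ → ℝ → BanditProg P ℝ
  | 0, acc => ret acc
  | n + 1, acc => play μ fun x => sumRewards μ n (acc + x)

/-- Play `n` episodes with independent policies drawn from `μ`; return the average reward. -/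
def sampleMean {P : Type} (μ : PMF P) (n : ℕ) : BanditProg P ℝ :=
  (sumRewards μ n 0).bind fun s => ret (s / n)

/-- The empirical average reward of `n` episodes for each action in a list. -/
def estimate {P : Type} {A : ℕ} (μ : Fin A → PMF P) (n : ℕ) :
    List (Fin A) → BanditProg P (Fin A → ℝ)
  | [] => ret fun _ => 0
  | a :: as => (sampleMean (μ a) n).bind fun m =>
      (estimate μ n as).bind fun f => ret (Function.update f a m)

end BanditProg

/-! ### The algorithm -/

/-- Non-empty sets of actions. -/
abbrev ActionSet (A : ℕ) : Type := {S : Finset (Fin A) // S.Nonempty}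

/-- The set of all actions. -/
def ActionSet.full (A : ℕ) [NeZero A] : ActionSet A := ⟨Finset.univ, Finset.univ_nonempty⟩

/-- A maximizer of `f` over `S` (the one with the smallest index). -/
def ActionSet.argmax {A : ℕ} (S : ActionSet A) (f : Fin A → ℝ) : Fin A :=
  (S.1.filter fun a => ∀ b ∈ S.1, f b ≤ f a).min' <| by
    obtain ⟨a, ha, h⟩ := S.1.exists_max_image f S.2
    exact ⟨a, Finset.mem_filter.2 ⟨ha, h⟩⟩

theorem ActionSet.argmax_mem {A : ℕ} (S : ActionSet A) (f : Fin A → ℝ) : S.argmax f ∈ S.1 :=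
  (Finset.mem_filter.1 (Finset.min'_mem _ _)).1

/-- The actions of `S` whose `f`-value is within `δ ≥ 0` of the maximum of `f` over `S`. -/
def ActionSet.refine {A : ℕ} (S : ActionSet A) (f : Fin A → ℝ) (δ : NNReal) : ActionSet A :=
  ⟨S.1.filter fun a => f (S.argmax f) - δ ≤ f a,
    S.argmax f, Finset.mem_filter.2 ⟨S.argmax_mem f, by simp⟩⟩

/-- One non-empty set of active actions for every state. -/
abbrev ActiveSets (H k A : ℕ) : Type := Fin H → Fin k → ActionSet A

/-- The law of a random policy whose actions in the different states are independent. -/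
def productPolicy {H k A : ℕ} (μ : Fin H → Fin k → PMF (Fin A)) : PMF (Policy H k A) :=
  PMF.ofFintype (fun π => ∏ i, ∏ l, μ i l (π i l)) <| by
    have h1 : ∀ i l, ∑ a, μ i l a = 1 := fun i l => by
      rw [← tsum_fintype (L := .unconditional _), (μ i l).tsum_coe]
    have h2 : ∀ i, ∑ f : Fin k → Fin A, ∏ l, μ i l (f l) = 1 := fun i => by
      rw [← Fintype.prod_sum (fun l a => μ i l a)]
      simp [h1]
    rw [← Fintype.prod_sum (fun i (f : Fin k → Fin A) => ∏ l, μ i l (f l))]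
    simp [h2]

/-- The exploration action in a state with action set `S`: with probability `k / (2H)` uniform on `S`,
and otherwise the maximal action of `S` with respect to the order `o`. -/
def exploreAction {H k A : ℕ} (hkH : k ≤ H) (o : LinearOrder (Fin A)) (S : ActionSet A) :
    PMF (Fin A) :=
  PMF.ofFintype
    (fun a => (k / (2 * H) : ENNReal) * PMF.uniformOfFinset S.1 S.2 a +
      (1 - k / (2 * H) : ENNReal) * PMF.pure (@Finset.max' _ o S.1 S.2) a) <| by
    have h1 : ∀ p : PMF (Fin A), ∑ a, p a = 1 := fun p => by
      rw [← tsum_fintype (L := .unconditional _), p.tsum_coe]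
    have hq : (k / (2 * H) : ENNReal) ≤ 1 := by
      refine ENNReal.div_le_of_le_mul ?_
      rw [one_mul, two_mul]
      exact le_trans (by exact_mod_cast hkH) le_self_add
    rw [Finset.sum_add_distrib, ← Finset.mul_sum, ← Finset.mul_sum, h1, h1, mul_one, mul_one]
    exact add_tsub_cancel_of_le hq

/-- The random policy used to test action `a` in state `(l, i)`: explore in all earlier stages and in
the other states of stage `i`, play `a` in `(l, i)`, and play `α` in all later stages. -/
def testPolicy {H k A : ℕ} (hkH : k ≤ H) (ord : Fin H → Fin k → LinearOrder (Fin A))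
    (S : ActiveSets H k A) (α : Policy H k A) (i : Fin H) (l : Fin k) (a : Fin A) :
    PMF (Policy H k A) :=
  productPolicy fun j s =>
    if i < j then PMF.pure (α j s)
    else if j = i ∧ s = l then PMF.pure a
    else exploreAction hkH (ord j s) (S j s)

/-- The threshold constant `C_{l,i} = e^{(H-i)k/H} (2AH/k)^{l-1} (H-i+1)^l`, in terms of the zero-based
indices of stage and level. -/
def thresholdConst (H k A : ℕ) (i : Fin H) (l : Fin k) : NNReal :=
  Real.toNNReal (Real.exp (((H : ℝ) - 1 - (i : ℕ)) * (k / H))) *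
    (2 * A * H / k) ^ (l : ℕ) * ((H - (i : ℕ) : ℕ) : NNReal) ^ ((l : ℕ) + 1)

/-- The states, ordered by decreasing stage and, within a stage, by decreasing level. -/
def statesBackward (H k : ℕ) : List (Fin H × Fin k) :=
  (List.finRange H).reverse ×ˢ (List.finRange k).reverse

/-- The learning loop of one phase over a list of states. The state of the loop consists of the
empirically best actions `α` and the refined action sets `N` found so far. -/
def learningLoop {H k A : ℕ} (hkH : k ≤ H) (ord : Fin H → Fin k → LinearOrder (Fin A))
    (n : ℕ) (ε : NNReal) (S : ActiveSets H k A) :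
    List (Fin H × Fin k) → Policy H k A → ActiveSets H k A →
      BanditProg (Policy H k A) (ActiveSets H k A)
  | [], _, N => .ret N
  | (i, l) :: rest, α, N =>
    (BanditProg.estimate (testPolicy hkH ord S α i l) n ((S i l).1.sort (· ≤ ·))).bind fun Φ =>
      learningLoop hkH ord n ε S rest
        (Function.update α i (Function.update (α i) l ((S i l).argmax Φ)))
        (Function.update N i (Function.update (N i) l
          ((S i l).refine Φ (thresholdConst H k A i l * ε))))

/-- One phase (ordered explore-then-refine) with accuracy `ε` and action sets `S`, using
`⌈12 log T / ε²⌉` episodes for each empirical average; it returns the refined action sets. -/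
def orderedExpRef {H k A : ℕ} [NeZero A] (hkH : k ≤ H)
    (ord : Fin H → Fin k → LinearOrder (Fin A)) (T : ℕ) (ε : NNReal) (S : ActiveSets H k A) :
    BanditProg (Policy H k A) (ActiveSets H k A) :=
  learningLoop hkH ord ⌈12 * Real.log T / (ε : ℝ) ^ 2⌉₊ ε S (statesBackward H k) (fun _ _ => 0) S

/-- `m` consecutive phases with accuracies `2^{-r}, 2^{-(r+1)}, …`. -/
def runPhases {H k A : ℕ} [NeZero A] (hkH : k ≤ H)
    (ord : Fin H → Fin k → LinearOrder (Fin A)) (T : ℕ) :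
    ℕ → ℕ → ActiveSets H k A → BanditProg (Policy H k A) (ActiveSets H k A)
  | 0, _, S => .ret S
  | m + 1, r, S => (orderedExpRef hkH ord T ((1 / 2) ^ r) S).bind (runPhases hkH ord T m (r + 1))

/-- The number of iterations of the loop `while ε > √(H k A log T / T)` that starts with `ε = 1` and
halves `ε` in every iteration. -/
def numPhases (H k A T : ℕ) : ℕ :=
  sInf {r : ℕ | (1 / 2 : ℝ) ^ r ≤ √(H * k * A * Real.log T / T)}

/-- The complete algorithm for horizon `T`: starting with all actions active, run the phases, and then
play a policy that uses active actions only. When it is run for `T` episodes, everything after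
episode `T` is cut off. Besides `H`, `k`, `A`, `T` it only knows the orders on the actions. -/
def orderedAlgorithm {H k A : ℕ} [NeZero A] (hkH : k ≤ H)
    (ord : Fin H → Fin k → LinearOrder (Fin A)) (T : ℕ) : OnlineAlgorithm H k A :=
  ((runPhases hkH ord T (numPhases H k A T) 0 (fun _ _ => ActionSet.full A)).bind fun S =>
    .ret fun i l => (S i l).1.min' (S i l).2).act

/-! ### Applications

For each problem, `…MDP` is the episodic MDP that models it and `…Run` is the total reward of a
direct execution (of the last `n` stages) on given realizations of the random variables. Level `c` of
the MDP is the remaining capacity. -/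

/-- The order on the actions given by their indices. -/
abbrev indexOrder (H k A : ℕ) : Fin H → Fin k → LinearOrder (Fin A) := fun _ _ => inferInstance

/-- `k`-item prophet inequality: action `a` for item `i` is the threshold `τ i a`; the item is selected
if its value exceeds the threshold. -/
def prophetRun {H k A : ℕ} (τ : Fin H → Fin A → ℝ) (π : Policy H k A) (x : Fin H → ℝ) :
    (n : ℕ) → n ≤ H → Fin (k + 1) → ℝ
  | 0, _, _ => 0
  | n + 1, h, c =>
    Fin.cases (motive := fun _ => ℝ) 0
      (fun l =>
        if τ (Fin.rev ⟨n, h⟩) (π (Fin.rev ⟨n, h⟩) l) < x (Fin.rev ⟨n, h⟩) then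
          x (Fin.rev ⟨n, h⟩) + prophetRun τ π x n (Nat.le_of_succ_le h) l.castSucc
        else prophetRun τ π x n (Nat.le_of_succ_le h) l.succ) c

/-- The MDP of the `k`-item prophet inequality with independent values of laws `μ i`. -/
def prophetMDP {H A : ℕ} (k : ℕ) (μ : Fin H → Measure ℝ) [∀ i, IsProbabilityMeasure (μ i)]
    (τ : Fin H → Fin A → ℝ) : EpisodicMDP H k A where
  step i l a := (μ i).map fun x => if τ i a < x then (x, l.castSucc) else (0, l.succ)
  isProbabilityMeasure_step _ _ _ := Measure.isProbabilityMeasure_map <|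
    (Measurable.ite measurableSet_Ioi (measurable_id.prodMk measurable_const)
      measurable_const).aemeasurable

/-- Sequential posted pricing: action `a` for customer `i` is the price `p i a`; the customer buys and
pays the price if her valuation is at least the price. -/
def pricingRun {H k A : ℕ} (p : Fin H → Fin A → ℝ) (π : Policy H k A) (x : Fin H → ℝ) :
    (n : ℕ) → n ≤ H → Fin (k + 1) → ℝ
  | 0, _, _ => 0
  | n + 1, h, c =>
    Fin.cases (motive := fun _ => ℝ) 0
      (fun l =>
        if p (Fin.rev ⟨n, h⟩) (π (Fin.rev ⟨n, h⟩) l) ≤ x (Fin.rev ⟨n, h⟩) then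
          p (Fin.rev ⟨n, h⟩) (π (Fin.rev ⟨n, h⟩) l) +
            pricingRun p π x n (Nat.le_of_succ_le h) l.castSucc
        else pricingRun p π x n (Nat.le_of_succ_le h) l.succ) c

/-- The MDP of sequential posted pricing with independent valuations of laws `μ i`. -/
def pricingMDP {H A : ℕ} (k : ℕ) (μ : Fin H → Measure ℝ) [∀ i, IsProbabilityMeasure (μ i)]
    (p : Fin H → Fin A → ℝ) : EpisodicMDP H k A where
  step i l a := (μ i).map fun x => if p i a ≤ x then (p i a, l.castSucc) else (0, l.succ)
  isProbabilityMeasure_step _ _ _ := Measure.isProbabilityMeasure_map <|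
    (Measurable.ite measurableSet_Ici measurable_const measurable_const).aemeasurable

/-- The effect of accepting a knapsack item with reward `z.1` and cost `z.2` when the remaining budget
is `l + 1`: the collected reward and the new budget. An item that overflows the budget gives no reward
and ends the execution. -/
def knapsackAccept {k : ℕ} (l : Fin k) (z : ℝ × ℕ) : ℝ × Fin (k + 1) :=
  if z.2 ≤ (l : ℕ) + 1 then (z.1, ⟨(l : ℕ) + 1 - z.2, by omega⟩) else (0, 0)

theorem measurable_knapsackAccept {k : ℕ} (l : Fin k) : Measurable (knapsackAccept l) :=
  Measurable.ite (measurable_snd (MeasurableSet.of_discrete (s := {c : ℕ | c ≤ (l : ℕ) + 1})))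
    (measurable_fst.prodMk ((Measurable.of_discrete
      (f := fun c : ℕ => (⟨(l : ℕ) + 1 - c, by omega⟩ : Fin (k + 1)))).comp measurable_snd))
    measurable_const

/-- Stochastic knapsack with items in a fixed order; action `0` is "accept" and action `1` is
"reject". The execution ends when the budget is used up or exceeded. -/
def knapsackRun {H k : ℕ} (π : Policy H k 2) (z : Fin H → ℝ × ℕ) :
    (n : ℕ) → n ≤ H → Fin (k + 1) → ℝ
  | 0, _, _ => 0
  | n + 1, h, c =>
    Fin.cases (motive := fun _ => ℝ) 0
      (fun l =>
        if π (Fin.rev ⟨n, h⟩) l = 0 then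
          (knapsackAccept l (z (Fin.rev ⟨n, h⟩))).1 +
            knapsackRun π z n (Nat.le_of_succ_le h) (knapsackAccept l (z (Fin.rev ⟨n, h⟩))).2
        else knapsackRun π z n (Nat.le_of_succ_le h) l.succ) c

/-- The MDP of stochastic knapsack, where `μ i` is the joint law of reward and cost of item `i`. -/
def knapsackMDP {H : ℕ} (k : ℕ) (μ : Fin H → Measure (ℝ × ℕ)) [∀ i, IsProbabilityMeasure (μ i)] :
    EpisodicMDP H k 2 where
  step i l a := if a = 0 then (μ i).map (knapsackAccept l) else Measure.dirac (0, l.succ)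
  isProbabilityMeasure_step i l a := by
    split_ifs
    · exact Measure.isProbabilityMeasure_map (measurable_knapsackAccept l).aemeasurable
    · infer_instance

end

end BanditMDP

namespace BanditMDP

noncomputable section

/-! ### Values of deterministic policies and of behavioural strategies -/

/-! Let `q` be the probability that exploration within the current active sets reaches a state `(l,
i)`. A test of action `a` there has mean reward `B + q * (value of a, followed by the policy α)`
with `B` independent of `a` (`exists_mixValue_testPolicy_eq`). Total rewards thus reveal action
values weighted by `q`, and nothing better is needed: what is rarely reached matters little. All
comparisons of values are therefore made after multiplication by `q`.

Such comparisons are propagated backwards over the stages by `reach_mul_actionValue_le`. If an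
active action leads from `l` down to `s < l`, the weight changes by a factor of at most `2AH/k`
(`uniformFactor`), since exploration plays every active action with probability at least `k/(2HA)`.
If the level stays the same, the factor is only `e^{k/H}` (`stayFactor`): the maximal active action
is the most likely one to stay, and it is played with probability at least `1 - k/(2H)`. Levels
never increase, so the expensive factor is paid once per descent and not once per stage, while the
cheap factors multiply to at most `e^k`. The thresholds solve the resulting recursion
(`levelConst_succ`).

Hence, if all estimates of a phase are accurate to `ε/2`, no optimal action is discarded
(`optimal_of_isAccurate`), and every policy using surviving actions is `phaseLoss * ε`-optimal
(`refined_of_isAccurate`, `totalValue_le_of_isAccurate`). Phase `r` takes at most `HkA` averages of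
about `12 * 4^r * log T` episodes, each losing `O(phaseLoss / 2^r)`. The sum over the phases is
geometric, and both it and the loss of the remaining episodes are of order `phaseLoss * √(HkA T log
T)`.

Estimation errors are handled without a probability space for the whole run. `Guarantee` bounds the
regret of a program followed by any continuation that is cheap on good outcomes; a bad outcome costs
at most `T`, which is dominated by exponential weights in the sum of the rewards
(`cost_sumRewards_le`, `guarantee_sampleMean`). Each average then contributes at most 1 to the
regret, and guarantees compose additively.

The applications share one argument: with independent data the MDP is the law of a direct execution
(`tailLaw_eq_map_dataRun`), and using the same data for two actions shows pointwise that the larger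
action stays whenever the smaller one does. -/

theorem PMF_sum_coe {α : Type*} [Fintype α] (p : PMF α) : ∑ a, p a = 1 := by
  rw [← tsum_fintype (L := .unconditional _), p.tsum_coe]

/-- Behavioural strategies: a distribution of the action for every state. -/
abbrev Strategy (H k A : ℕ) : Type := Fin H → Fin k → PMF (Fin A)

/-- The strategy that follows a deterministic policy. -/
def pureStrategy {H k A : ℕ} (π : Policy H k A) : Strategy H k A := fun i l => PMF.pure (π i l)

namespace EpisodicMDP

variable {H k A : ℕ} (M : EpisodicMDP H k A)

/-- The expected reward collected in level `l` of stage `i` under action `a`. -/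
def meanReward (i : Fin H) (l : Fin k) (a : Fin A) : ENNReal :=
  ∫⁻ z, ENNReal.ofReal z.1 ∂(M.step i l a)

/-- The transition probability, as an extended non-negative real. -/
def trans (i : Fin H) (l : Fin k) (a : Fin A) (s : Fin (k + 1)) : ENNReal :=
  M.step i l a {z | z.2 = s}

/-- The value of action `a` in level `l` of stage `i` if `W` is the value of the next level. -/
def actionValue (i : Fin H) (l : Fin k) (a : Fin A) (W : Fin (k + 1) → ENNReal) : ENNReal :=
  M.meanReward i l a + ∑ s, M.trans i l a s * W s

/-- The expected reward of a strategy in the last `n` stages. -/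
def tailValue (σ : Strategy H k A) : (n : ℕ) → n ≤ H → Fin (k + 1) → ENNReal
  | 0, _, _ => 0
  | n + 1, h, s =>
    Fin.cases (motive := fun _ => ENNReal) 0
      (fun l => ∑ a, σ (Fin.rev ⟨n, h⟩) l a *
        M.actionValue (Fin.rev ⟨n, h⟩) l a (tailValue σ n (Nat.le_of_succ_le h))) s

/-- The expected reward of a strategy from stage `i` on. -/
def valueFrom (σ : Strategy H k A) (i : ℕ) : Fin (k + 1) → ENNReal :=
  M.tailValue σ (H - i) (Nat.sub_le _ _)

theorem tailLaw_succ_succ (π : Policy H k A) (n : ℕ) (h : n + 1 ≤ H) (l : Fin k) :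
    M.tailLaw π (n + 1) h l.succ =
      (M.step (Fin.rev ⟨n, h⟩) l (π (Fin.rev ⟨n, h⟩) l)).bind fun z =>
          (M.tailLaw π n (Nat.le_of_succ_le h) z.2).map fun x => z.1 + x := by
  rw [tailLaw, Fin.cases_succ]

theorem tailLaw_zero (π : Policy H k A) (n : ℕ) (h : n ≤ H) :
    M.tailLaw π n h 0 = Measure.dirac 0 := by
  cases n with
  | zero => rfl
  | succ n => rw [tailLaw, Fin.cases_zero]

/-- `Measure.bind` can only be evaluated along measurable kernels. The level is discrete, so it may
be fixed; the mass of `B` is then the mass of a section of a measurable set in the plane. -/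
theorem measurable_map_add_left {β : Type*} [Countable β] [MeasurableSpace β]
    [MeasurableSingletonClass β] (κ : β → Measure ℝ) [∀ s, IsProbabilityMeasure (κ s)] :
    Measurable fun z : ℝ × β => (κ z.2).map fun x => z.1 + x := by
  refine measurable_from_prod_countable_left fun s => ?_
  refine Measure.measurable_of_measurable_coe _ fun B hB => ?_
  have : ∀ r : ℝ, ((κ s).map fun x => r + x) B = κ s (Prod.mk r ⁻¹' {p : ℝ × ℝ | p.1 + p.2 ∈ B}) :=
    fun r => Measure.map_apply (measurable_const_add r) hB
  simp only [this]
  exact measurable_measure_prodMk_left ((measurable_fst.add measurable_snd) hB)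

theorem isProbabilityMeasure_tailLaw (π : Policy H k A) (n : ℕ) (h : n ≤ H) (s : Fin (k + 1)) :
    IsProbabilityMeasure (M.tailLaw π n h s) := by
  induction n generalizing s with
  | zero => rw [tailLaw]; infer_instance
  | succ n ih =>
    cases s using Fin.cases with
    | zero => rw [tailLaw_zero]; infer_instance
    | succ l =>
      have := fun s => ih (Nat.le_of_succ_le h) s
      have := M.isProbabilityMeasure_step
      refine ⟨?_⟩
      rw [tailLaw_succ_succ, Measure.bind_apply .univ (measurable_map_add_left _).aemeasurable]
      have : ∀ z : ℝ × Fin (k + 1),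
          ((M.tailLaw π n (Nat.le_of_succ_le h) z.2).map fun x => z.1 + x) Set.univ = 1 := fun z => by
        rw [Measure.map_apply (measurable_const_add _) .univ, Set.preimage_univ, measure_univ]
      simp [this]

instance (π : Policy H k A) : IsProbabilityMeasure (M.rewardLaw π) :=
  M.isProbabilityMeasure_tailLaw π H le_rfl _

theorem lintegral_tailLaw_succ (π : Policy H k A) (n : ℕ) (h : n + 1 ≤ H) (l : Fin k)
    {f : ℝ → ENNReal} (hf : Measurable f) :
    ∫⁻ x, f x ∂(M.tailLaw π (n + 1) h l.succ) =
      ∫⁻ z, ∫⁻ x, f (z.1 + x) ∂(M.tailLaw π n (Nat.le_of_succ_le h) z.2)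
        ∂(M.step (Fin.rev ⟨n, h⟩) l (π (Fin.rev ⟨n, h⟩) l)) := by
  have := fun s => M.isProbabilityMeasure_tailLaw π n (Nat.le_of_succ_le h) s
  rw [tailLaw_succ_succ, Measure.lintegral_bind (measurable_map_add_left _).aemeasurable
    hf.aemeasurable]
  refine lintegral_congr fun z => ?_
  rw [lintegral_map hf (measurable_const_add _)]

theorem tailLaw_nonneg (hM : ∀ i l a, ∀ᵐ z ∂(M.step i l a), 0 ≤ z.1)
    (π : Policy H k A) (n : ℕ) (h : n ≤ H) (s : Fin (k + 1)) :
    ∀ᵐ x ∂(M.tailLaw π n h s), 0 ≤ x := by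
  induction n generalizing s with
  | zero => rw [tailLaw, ae_dirac_iff measurableSet_Ici]
  | succ n ih =>
    cases s using Fin.cases with
    | zero => rw [tailLaw_zero, ae_dirac_iff measurableSet_Ici]
    | succ l =>
      have := fun s => M.isProbabilityMeasure_tailLaw π n (Nat.le_of_succ_le h) s
      rw [tailLaw_succ_succ, ae_iff, Measure.bind_apply (by measurability)
        (measurable_map_add_left _).aemeasurable, lintegral_eq_zero_iff']
      · filter_upwards [hM _ _ _] with z hz
        have : ∀ᵐ x ∂((M.tailLaw π n (Nat.le_of_succ_le h) z.2).map fun x => z.1 + x), 0 ≤ x := by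
          rw [ae_map_iff (measurable_const_add _).aemeasurable measurableSet_Ici]
          filter_upwards [ih (Nat.le_of_succ_le h) z.2] with x hx using add_nonneg hz hx
        exact ae_iff.1 this
      · exact ((Measure.measurable_coe (by measurability)).comp
          (measurable_map_add_left _)).aemeasurable

theorem lintegral_snd_step (i : Fin H) (l : Fin k) (a : Fin A) (W : Fin (k + 1) → ENNReal) :
    ∫⁻ z, W z.2 ∂(M.step i l a) = ∑ s, M.trans i l a s * W s := by
  rw [← lintegral_map (g := fun z : ℝ × Fin (k + 1) => z.2) (f := W) (Measurable.of_discrete)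
    measurable_snd, lintegral_fintype]
  refine Finset.sum_congr rfl fun s _ => ?_
  rw [Measure.map_apply measurable_snd (measurableSet_singleton _), mul_comm]
  rfl

theorem tailValue_succ_succ (σ : Strategy H k A) (n : ℕ) (h : n + 1 ≤ H) (l : Fin k) :
    M.tailValue σ (n + 1) h l.succ = ∑ a, σ (Fin.rev ⟨n, h⟩) l a *
        M.actionValue (Fin.rev ⟨n, h⟩) l a (M.tailValue σ n (Nat.le_of_succ_le h)) := by
  rw [tailValue, Fin.cases_succ]

theorem tailValue_zero (σ : Strategy H k A) (n : ℕ) (h : n ≤ H) :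
    M.tailValue σ n h 0 = 0 := by
  cases n with
  | zero => rfl
  | succ n => rw [tailValue, Fin.cases_zero]

theorem sum_pure_mul (b : Fin A) (f : Fin A → ENNReal) :
    ∑ a, PMF.pure b a * f a = f b := by
  simp [PMF.pure_apply]

/-- The mean of the reward law obeys the Bellman recursion. `ENNReal.ofReal` is additive on
non-negative numbers only, so both the current and the later reward must be almost surely
non-negative. -/
theorem lintegral_tailLaw (hM : ∀ i l a, ∀ᵐ z ∂(M.step i l a), 0 ≤ z.1)
    (π : Policy H k A) (n : ℕ) (h : n ≤ H) (s : Fin (k + 1)) :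
    ∫⁻ x, ENNReal.ofReal x ∂(M.tailLaw π n h s) = M.tailValue (pureStrategy π) n h s := by
  induction n generalizing s with
  | zero => simp [tailLaw, tailValue]
  | succ n ih =>
    cases s using Fin.cases with
    | zero => simp [tailLaw_zero, tailValue_zero]
    | succ l =>
      have := fun s => M.isProbabilityMeasure_tailLaw π n (Nat.le_of_succ_le h) s
      rw [lintegral_tailLaw_succ _ _ _ _ _ ENNReal.measurable_ofReal, tailValue_succ_succ]
      unfold pureStrategy
      rw [sum_pure_mul, actionValue, meanReward, ← lintegral_snd_step,
        ← lintegral_add_left (by fun_prop)]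
      refine lintegral_congr_ae ?_
      filter_upwards [hM _ _ _] with z hz
      have : ∫⁻ x, ENNReal.ofReal (z.1 + x) ∂(M.tailLaw π n (Nat.le_of_succ_le h) z.2) =
          ∫⁻ x, ENNReal.ofReal z.1 + ENNReal.ofReal x
            ∂(M.tailLaw π n (Nat.le_of_succ_le h) z.2) := by
        refine lintegral_congr_ae ?_
        filter_upwards [M.tailLaw_nonneg hM π n (Nat.le_of_succ_le h) z.2] with x hx
        exact ENNReal.ofReal_add hz hx
      rw [this, lintegral_add_left (by fun_prop), ih]
      simp
      rfl

theorem valueFrom_zero (σ : Strategy H k A) (i : ℕ) : M.valueFrom σ i 0 = 0 :=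
  M.tailValue_zero _ _ _

theorem valueFrom_last (σ : Strategy H k A) : M.valueFrom σ H = 0 := by
  funext s
  unfold valueFrom
  generalize_proofs h
  -- The proof of `H - H ≤ H` is abstracted so that the number of stages it depends on can be
  -- rewritten.
  revert h
  rw [Nat.sub_self]
  exact fun _ => rfl

theorem valueFrom_succ (σ : Strategy H k A) (i : Fin H) (l : Fin k) :
    M.valueFrom σ i l.succ = ∑ a, σ i l a * M.actionValue i l a (M.valueFrom σ (i + 1)) := by
  unfold valueFrom
  generalize_proofs h1 h2
  revert h1
  have : H - (i : ℕ) = (H - (i + 1)) + 1 := by omega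
  rw [this]
  intro h1
  rw [tailValue_succ_succ]
  have : Fin.rev ⟨H - (i + 1), h1⟩ = i := by ext; simp; omega
  rw [this]

theorem valueFrom_pure_succ (π : Policy H k A) (i : Fin H) (l : Fin k) :
    M.valueFrom (pureStrategy π) i l.succ =
      M.actionValue i l (π i l) (M.valueFrom (pureStrategy π) (i + 1)) := by
  rw [valueFrom_succ]
  exact sum_pure_mul _ _

/-- Backward induction over the stages. -/
theorem backward_induction {P : ℕ → Prop} (last : P H) (step : ∀ i : Fin H, P (i + 1) → P i)
    (i : ℕ) (hi : i ≤ H) : P i :=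
  Nat.decreasingInduction (motive := fun m _ => P m) (fun m hm ih => step ⟨m, hm⟩ ih) last hi

theorem valueFrom_congr {σ τ : Strategy H k A} (i : ℕ) (hi : i ≤ H)
    (h : ∀ j : Fin H, i ≤ j → σ j = τ j) : M.valueFrom σ i = M.valueFrom τ i := by
  revert h
  refine backward_induction (P := fun i => (∀ j : Fin H, i ≤ j → σ j = τ j) →
    M.valueFrom σ i = M.valueFrom τ i) (fun _ => by simp [valueFrom_last]) (fun i ih h => ?_) i hi
  funext s
  cases s using Fin.cases with
  | zero => simp [valueFrom_zero]
  | succ l =>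
    rw [valueFrom_succ, valueFrom_succ, h i le_rfl, ih fun j hj => h j (by omega)]

theorem actionValue_mono (i : Fin H) (l : Fin k) (a : Fin A) {U W : Fin (k + 1) → ENNReal}
    (h : ∀ s, U s ≤ W s) : M.actionValue i l a U ≤ M.actionValue i l a W :=
  add_le_add_right (Finset.sum_le_sum fun s _ => mul_le_mul_right (h s) _) _

/-! ### Optimal policies -/

variable [NeZero A]

/-- Optimality in all states at once, not only from the start, is needed: the phase analysis
compares values state by state. The policy is built backwards, with a greedy choice in each stage.
-/
theorem exists_optimal_policy :
    ∃ π : Policy H k A, ∀ (σ : Policy H k A) (i : ℕ), i ≤ H → ∀ s,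
      M.valueFrom (pureStrategy σ) i s ≤ M.valueFrom (pureStrategy π) i s := by
  have key : ∀ i ≤ H, ∃ π : Policy H k A, ∀ (σ : Policy H k A) (j : ℕ), i ≤ j → j ≤ H → ∀ s,
      M.valueFrom (pureStrategy σ) j s ≤ M.valueFrom (pureStrategy π) j s := by
    refine backward_induction ⟨fun _ _ => 0, fun σ j hj hj' s => ?_⟩ ?_
    · obtain rfl : j = H := le_antisymm hj' hj
      simp [valueFrom_last]
    · rintro i ⟨π, hπ⟩
      have : ∀ l, ∃ b, ∀ a, M.actionValue i l a (M.valueFrom (pureStrategy π) (i + 1)) ≤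
          M.actionValue i l b (M.valueFrom (pureStrategy π) (i + 1)) := fun l =>
        Finite.exists_max _
      choose b hb using this
      have hlater : ∀ j : ℕ, (i : ℕ) + 1 ≤ j → j ≤ H →
          M.valueFrom (pureStrategy (Function.update π i b)) j =
            M.valueFrom (pureStrategy π) j := fun j hj hj' => by
        refine M.valueFrom_congr j hj' fun m hm => ?_
        have : m ≠ i := by rintro rfl; omega
        unfold pureStrategy
        rw [Function.update_of_ne this]
      refine ⟨Function.update π i b, fun σ j hj hj' s => ?_⟩
      rcases Nat.eq_or_lt_of_le hj with rfl | hj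
      · cases s using Fin.cases with
        | zero => simp [valueFrom_zero]
        | succ l =>
          rw [valueFrom_pure_succ, valueFrom_pure_succ, hlater _ le_rfl i.2, Function.update_self]
          exact (M.actionValue_mono i l _ fun s => hπ σ _ le_rfl i.2 s).trans (hb l _)
      · rw [hlater j hj hj']
        exact hπ σ j hj hj' s
  obtain ⟨π, hπ⟩ := key 0 (Nat.zero_le _)
  exact ⟨π, fun σ i hi s => hπ σ i (Nat.zero_le _) hi s⟩

end EpisodicMDP

/-! ### Product policies -/

namespace EpisodicMDP
variable {H k A : ℕ} (M : EpisodicMDP H k A)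

/-- A detailed balance identity: the factors of all states other than `(i, l)` agree, and both sides
contain the weights of the old and of the new action in `(i, l)`. -/
theorem productPolicy_update_mul (σ : Strategy H k A) (π : Policy H k A) (i : Fin H) (l : Fin k)
    (a : Fin A) :
    productPolicy σ (Function.update π i (Function.update (π i) l a)) * σ i l (π i l) =
      productPolicy σ π * σ i l a := by
  simp only [productPolicy, PMF.ofFintype_apply]
  rw [← Finset.mul_prod_erase _ _ (Finset.mem_univ i), ← Finset.mul_prod_erase (s := Finset.univ)
    (f := fun j => ∏ s, σ j s (π j s)) (Finset.mem_univ i),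
    ← Finset.mul_prod_erase _ _ (Finset.mem_univ l), ← Finset.mul_prod_erase (s := Finset.univ)
    (f := fun s => σ i s (π i s)) (Finset.mem_univ l)]
  have h1 : ∏ j ∈ Finset.univ.erase i,
      ∏ s, σ j s ((Function.update π i (Function.update (π i) l a)) j s) =
      ∏ j ∈ Finset.univ.erase i, ∏ s, σ j s (π j s) := by
    refine Finset.prod_congr rfl fun j hj => ?_
    rw [Function.update_of_ne (Finset.ne_of_mem_erase hj)]
  have h2 : ∏ s ∈ Finset.univ.erase l,
      σ i s ((Function.update π i (Function.update (π i) l a)) i s) =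
      ∏ s ∈ Finset.univ.erase l, σ i s (π i s) := by
    refine Finset.prod_congr rfl fun s hs => ?_
    rw [Function.update_self, Function.update_of_ne (Finset.ne_of_mem_erase hs)]
  rw [h1, h2, Function.update_self, Function.update_self]
  ring

/-- Resampling the action in one state does not change the law of a product policy. -/
theorem sum_productPolicy_resample (σ : Strategy H k A) (i : Fin H) (l : Fin k)
    (F : Policy H k A → ENNReal) :
    ∑ π, productPolicy σ π * F π = ∑ π, productPolicy σ π *
      ∑ a, σ i l a * F (Function.update π i (Function.update (π i) l a)) := by
  have h1 : ∑ π, productPolicy σ π * F π =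
      ∑ p : Policy H k A × Fin A, productPolicy σ p.1 * σ i l p.2 * F p.1 := by
    rw [Fintype.sum_prod_type]
    refine Finset.sum_congr rfl fun π _ => ?_
    simp only [mul_assoc]
    rw [← Finset.mul_sum, ← Finset.sum_mul, PMF_sum_coe, one_mul]
  have h2 : ∑ π, productPolicy σ π *
      ∑ a, σ i l a * F (Function.update π i (Function.update (π i) l a)) =
      ∑ p : Policy H k A × Fin A, productPolicy σ p.1 * σ i l p.2 *
        F (Function.update p.1 i (Function.update (p.1 i) l p.2)) := by
    rw [Fintype.sum_prod_type]
    simp only [Finset.mul_sum, mul_assoc]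
  rw [h1, h2]
  -- Exchanging the stored action in `(i, l)` with the fresh one is an involution; by detailed
  -- balance it preserves the weight.
  let e : Policy H k A × Fin A → Policy H k A × Fin A := fun p =>
    (Function.update p.1 i (Function.update (p.1 i) l p.2), p.1 i l)
  have he : Function.Involutive e := by
    rintro ⟨π, a⟩
    simp [e]
  rw [← Equiv.sum_comp he.toPerm]
  refine Finset.sum_congr rfl fun p _ => ?_
  change productPolicy σ (Function.update p.1 i (Function.update (p.1 i) l p.2)) *
    σ i l (p.1 i l) * F (Function.update p.1 i (Function.update (p.1 i) l p.2)) = _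
  rw [productPolicy_update_mul]

theorem actionValue_sum {ι : Type*} [Fintype ι] (i : Fin H) (l : Fin k) (a : Fin A) (w : PMF ι)
    (W : ι → Fin (k + 1) → ENNReal) :
    ∑ j, w j * M.actionValue i l a (W j) = M.actionValue i l a fun s => ∑ j, w j * W j s := by
  simp only [actionValue, mul_add, Finset.sum_add_distrib, ← Finset.sum_mul, PMF_sum_coe, one_mul,
    Finset.mul_sum]
  rw [Finset.sum_comm]
  congr 1
  exact Finset.sum_congr rfl fun _ _ => Finset.sum_congr rfl fun _ _ => mul_left_comm _ _ _

/-- The mean value of a product policy is the value of the corresponding behavioural strategy. -/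
theorem sum_productPolicy_valueFrom (σ : Strategy H k A) (i : ℕ) (hi : i ≤ H) (s : Fin (k + 1)) :
    ∑ π, productPolicy σ π * M.valueFrom (pureStrategy π) i s = M.valueFrom σ i s := by
  revert s
  refine backward_induction (P := fun i => ∀ s, ∑ π, productPolicy σ π *
    M.valueFrom (pureStrategy π) i s = M.valueFrom σ i s) (by simp [valueFrom_last])
    (fun i ih s => ?_) i hi
  cases s using Fin.cases with
  | zero => simp [valueFrom_zero]
  | succ l =>
    -- After resampling, the action in `(i, l)` is independent of the rest of the policy, and the
    -- value from stage `i + 1` on does not see stage `i`.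
    rw [sum_productPolicy_resample σ i l, valueFrom_succ]
    have : ∀ (π : Policy H k A) (a : Fin A), M.valueFrom
        (pureStrategy (Function.update π i (Function.update (π i) l a))) i l.succ =
        M.actionValue i l a (M.valueFrom (pureStrategy π) (i + 1)) := fun π a => by
      rw [valueFrom_pure_succ, Function.update_self, Function.update_self]
      congr 1
      refine M.valueFrom_congr _ i.2 fun m hm => ?_
      have : m ≠ i := by rintro rfl; omega
      unfold pureStrategy
      rw [Function.update_of_ne this]
    simp only [this, Finset.mul_sum]
    rw [Finset.sum_comm]
    refine Finset.sum_congr rfl fun a _ => ?_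
    simp only [mul_left_comm _ (σ i l a), ← Finset.mul_sum]
    rw [actionValue_sum]
    simp only [ih]

end EpisodicMDP

/-! ### Reaching probabilities -/

namespace EpisodicMDP
variable {H k A : ℕ} (M : EpisodicMDP H k A)

/-- The probability that a strategy reaches a level in stage `i`. -/
def reach (σ : Strategy H k A) : ℕ → Fin (k + 1) → ENNReal
  | 0, s => if s = Fin.last k then 1 else 0
  | i + 1, s => if h : i < H then
      ∑ l : Fin k, reach σ i l.succ * ∑ a, σ ⟨i, h⟩ l a * M.trans ⟨i, h⟩ l a s else 0

/-- The expected reward of a strategy before stage `i`. -/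
def gained (σ : Strategy H k A) : ℕ → ENNReal
  | 0 => 0
  | i + 1 => gained σ i + if h : i < H then
      ∑ l : Fin k, M.reach σ i l.succ * ∑ a, σ ⟨i, h⟩ l a * M.meanReward ⟨i, h⟩ l a else 0

theorem reach_succ (σ : Strategy H k A) (i : Fin H) (s : Fin (k + 1)) :
    M.reach σ (i + 1) s =
      ∑ l : Fin k, M.reach σ i l.succ * ∑ a, σ i l a * M.trans i l a s := by
  rw [reach, dif_pos i.2]

theorem gained_succ (σ : Strategy H k A) (i : Fin H) :
    M.gained σ (i + 1) = M.gained σ i +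
      ∑ l : Fin k, M.reach σ i l.succ * ∑ a, σ i l a * M.meanReward i l a := by
  rw [gained, dif_pos i.2]

theorem reach_congr {σ τ : Strategy H k A} (i : ℕ) (h : ∀ j : Fin H, (j : ℕ) < i → σ j = τ j) :
    M.reach σ i = M.reach τ i := by
  induction i with
  | zero => rfl
  | succ i ih =>
    funext s
    rw [reach, reach, ih fun j hj => h j (by omega)]
    split_ifs with hi
    · rw [h ⟨i, hi⟩ (by simp)]
    · rfl

theorem gained_congr {σ τ : Strategy H k A} (i : ℕ) (h : ∀ j : Fin H, (j : ℕ) < i → σ j = τ j) :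
    M.gained σ i = M.gained τ i := by
  induction i with
  | zero => rfl
  | succ i ih =>
    rw [gained, gained, ih fun j hj => h j (by omega),
      M.reach_congr i fun j hj => h j (by omega)]
    split_ifs with hi
    · rw [h ⟨i, hi⟩ (by simp)]
    · rfl

theorem reach_ne_top (σ : Strategy H k A) (i : ℕ) (s : Fin (k + 1)) : M.reach σ i s ≠ ⊤ := by
  induction i generalizing s with
  | zero => rw [reach]; split_ifs <;> simp
  | succ i ih =>
    rw [reach]
    split_ifs with hi
    · refine ENNReal.sum_ne_top.2 fun l _ => ENNReal.mul_ne_top (ih _) ?_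
      refine ENNReal.sum_ne_top.2 fun a _ => ENNReal.mul_ne_top (PMF.apply_ne_top _ _) ?_
      have := M.isProbabilityMeasure_step
      exact measure_ne_top _ _
    · simp

/-- The value of a strategy splits into the reward before stage `i` and from stage `i` on. -/
theorem valueFrom_start (σ : Strategy H k A) (i : ℕ) (hi : i ≤ H) :
    M.valueFrom σ 0 (Fin.last k) =
      M.gained σ i + ∑ l : Fin k, M.reach σ i l.succ * M.valueFrom σ i l.succ := by
  induction i with
  | zero =>
    -- Level `0` has value zero, so the sum may be extended to all of `Fin (k + 1)`.
    have := Fin.sum_univ_succ fun s => M.reach σ 0 s * M.valueFrom σ 0 s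
    rw [valueFrom_zero, mul_zero, zero_add] at this
    rw [← this, gained]
    simp [reach]
  | succ i ih =>
    rw [ih (by omega)]
    obtain ⟨i, rfl⟩ : ∃ j : Fin H, (j : ℕ) = i := ⟨⟨i, hi⟩, rfl⟩
    rw [gained_succ, add_assoc]
    congr 1
    have h2 := Fin.sum_univ_succ fun s => M.reach σ (i + 1) s * M.valueFrom σ (i + 1) s
    rw [valueFrom_zero, mul_zero, zero_add] at h2
    rw [← h2]
    simp only [valueFrom_succ, actionValue, reach_succ, mul_add, Finset.sum_add_distrib]
    congr 1
    simp only [Finset.mul_sum, Finset.sum_mul]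
    rw [Finset.sum_comm (s := (Finset.univ : Finset (Fin (k + 1))))]
    refine Finset.sum_congr rfl fun l _ => ?_
    rw [Finset.sum_comm]
    exact Finset.sum_congr rfl fun s _ => Finset.sum_congr rfl fun a _ => by ring

end EpisodicMDP

/-! ### Exploration -/

/-- The strategy that explores the action sets `S` in all states. -/
def exploreStrategy {H k A : ℕ} (hkH : k ≤ H) (ord : Fin H → Fin k → LinearOrder (Fin A))
    (S : ActiveSets H k A) : Strategy H k A := fun j s => exploreAction hkH (ord j s) (S j s)

/-- The inverse of the least probability of an action under exploration. -/
def uniformFactor (H k A : ℕ) : NNReal := 2 * A * H / k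

/-- The loss in the probability of staying in a level, per stage of exploration. -/
def stayFactor (H k : ℕ) : NNReal := Real.toNNReal (Real.exp (k / H))

/-- The threshold constant of level `l + 1` in terms of the number `m` of remaining stages. -/
def levelConst (H k A m l : ℕ) : NNReal :=
  stayFactor H k ^ (m - 1) * uniformFactor H k A ^ l * (m : NNReal) ^ (l + 1)

/-! ### Arithmetic of the threshold constants. -/

theorem one_le_stayFactor (H k : ℕ) : 1 ≤ stayFactor H k := by
  rw [stayFactor, Real.one_le_toNNReal]
  exact Real.one_le_exp (by positivity)

theorem one_le_uniformFactor {H k A : ℕ} (hk : 1 ≤ k) (hkH : k ≤ H) (hA : 1 ≤ A) :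
    1 ≤ uniformFactor H k A := by
  have hk' : (0 : NNReal) < k := by exact_mod_cast hk
  rw [uniformFactor, le_div_iff₀ hk', one_mul]
  exact_mod_cast (by nlinarith [Nat.mul_le_mul hA hkH] : k ≤ 2 * A * H)

theorem thresholdConst_eq {H k A : ℕ} (i : Fin H) (l : Fin k) :
    thresholdConst H k A i l = levelConst H k A (H - i) l := by
  rw [thresholdConst, levelConst, stayFactor, uniformFactor,
    ← Real.toNNReal_pow (Real.exp_nonneg _), ← Real.exp_nat_mul]
  have : (((H - (i : ℕ) - 1 : ℕ) : ℝ)) = (H : ℝ) - 1 - (i : ℕ) := by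
    rw [Nat.cast_sub (by omega), Nat.cast_sub (by omega)]
    push_cast; ring
  rw [this]

theorem one_le_levelConst {H k A : ℕ} (hk : 1 ≤ k) (hkH : k ≤ H) (hA : 1 ≤ A) {m : ℕ}
    (hm : 1 ≤ m) (l : ℕ) : 1 ≤ levelConst H k A m l := by
  unfold levelConst
  have hm' : (1 : NNReal) ≤ m := by exact_mod_cast hm
  exact one_le_mul (one_le_mul (one_le_pow₀ (one_le_stayFactor _ _))
    (one_le_pow₀ (one_le_uniformFactor hk hkH hA))) (one_le_pow₀ hm')

/-- The binomial theorem, with every binomial coefficient bounded below by 1. -/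
theorem sum_pow_le_succ_pow (m : NNReal) (l : ℕ) :
    ∑ s ∈ Finset.range (l + 1), m ^ s ≤ (m + 1) ^ l := by
  rw [add_pow]
  refine Finset.sum_le_sum fun s hs => ?_
  rw [one_pow, mul_one]
  refine le_mul_of_one_le_right zero_le ?_
  exact_mod_cast Nat.choose_pos (Finset.mem_range_succ_iff.1 hs)

/-- The recursion satisfied by the threshold constants. -/
theorem levelConst_succ {H k A : ℕ} (hk : 1 ≤ k) (hkH : k ≤ H) (hA : 1 ≤ A) (m l : ℕ) :
    stayFactor H k * levelConst H k A m l +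
      uniformFactor H k A * ∑ s ∈ Finset.range l, levelConst H k A m s + 1 ≤
      levelConst H k A (m + 1) l := by
  have hx := one_le_uniformFactor hk hkH hA
  have hy := one_le_stayFactor H k
  -- With no stages left the constants vanish, because of the factor `m ^ (l + 1)`; this also
  -- disposes of the truncated exponent `m - 1`.
  rcases Nat.eq_zero_or_pos m with rfl | hm
  · simpa [levelConst] using one_le_pow₀ hx
  simp only [levelConst]
  set x := uniformFactor H k A
  set y := stayFactor H k
  have hy1 : y * y ^ (m - 1) = y ^ (m + 1 - 1) := by
    rw [← pow_succ']; congr 1; omega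
  -- A descent from `l` to `s < l` costs one more factor `x`, and `s + 1 ≤ l`.
  have h1 : x * ∑ s ∈ Finset.range l, y ^ (m - 1) * x ^ s * (m : NNReal) ^ (s + 1) ≤
      y ^ (m + 1 - 1) * x ^ l * ∑ s ∈ Finset.range l, (m : NNReal) ^ (s + 1) := by
    rw [Finset.mul_sum, Finset.mul_sum]
    refine Finset.sum_le_sum fun s hs => ?_
    rw [← mul_assoc]
    gcongr ?_ * _
    rw [mul_left_comm, ← pow_succ']
    gcongr
    · omega
    · exact Finset.mem_range.1 hs
  have h0 : 1 ≤ y ^ (m + 1 - 1) * x ^ l := one_le_mul (one_le_pow₀ hy) (one_le_pow₀ hx)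
  -- Staying, descending and the additive 1 account for the powers `m ^ (l + 1)`, `m ^ 1, …, m ^ l`
  -- and `m ^ 0`, whose sum is at most `(m + 1) ^ (l + 1)`.
  calc _ ≤ y ^ (m + 1 - 1) * x ^ l * (m : NNReal) ^ (l + 1) +
        y ^ (m + 1 - 1) * x ^ l * ∑ s ∈ Finset.range l, (m : NNReal) ^ (s + 1) +
        y ^ (m + 1 - 1) * x ^ l := by
        refine add_le_add (add_le_add (le_of_eq ?_) h1) h0
        rw [← mul_assoc, ← mul_assoc, hy1]
    _ = y ^ (m + 1 - 1) * x ^ l * ∑ s ∈ Finset.range (l + 2), (m : NNReal) ^ s := by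
        rw [Finset.sum_range_succ, Finset.sum_range_succ', pow_zero]
        ring
    _ ≤ _ := by
        push_cast
        gcongr
        exact sum_pow_le_succ_pow _ _

/-- Only the uniform part counts: it has weight `k/(2H)`, and an active set has at most `A`
elements. -/
theorem le_uniformFactor_mul_exploreAction {H k A : ℕ} (hk : 1 ≤ k) (hkH : k ≤ H)
    (o : LinearOrder (Fin A)) (S : ActionSet A) {a : Fin A} (ha : a ∈ S.1) :
    1 ≤ (uniformFactor H k A : ENNReal) * exploreAction hkH o S a := by
  have hA : 0 < A := a.pos
  have hH : 0 < H := by omega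
  have h1 : (k / (2 * H) : ENNReal) * (A : ENNReal)⁻¹ ≤ exploreAction hkH o S a := by
    rw [exploreAction, PMF.ofFintype_apply, PMF.uniformOfFinset_apply_of_mem _ ha]
    refine le_trans (mul_le_mul_right ?_ _) le_self_add
    rw [ENNReal.inv_le_inv]
    exact_mod_cast (Finset.card_le_univ S.1).trans_eq (Fintype.card_fin A)
  refine le_trans (le_of_eq ?_) (mul_le_mul_right h1 _)
  have : (k / (2 * H) : ENNReal) * (A : ENNReal)⁻¹ =
      ((k / (2 * H) * (A : NNReal)⁻¹ : NNReal) : ENNReal) := by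
    have hH' : (2 * H : NNReal) ≠ 0 := by positivity
    have hA' : (A : NNReal) ≠ 0 := by positivity
    push_cast [ENNReal.coe_div hH', ENNReal.coe_inv hA']
    rfl
  rw [this, ← ENNReal.coe_mul, ← ENNReal.coe_one, ENNReal.coe_inj, uniformFactor]
  have hk' : (k : NNReal) ≠ 0 := by positivity
  have hH' : (H : NNReal) ≠ 0 := by positivity
  have hA' : (A : NNReal) ≠ 0 := by positivity
  field_simp

/-- For `t = k/H` in `[0, 1]`, `e^t (1 - t/2) ≥ (1 + t)(1 - t/2) = 1 + t(1 - t)/2 ≥ 1`. -/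
theorem le_stayFactor_mul_exploreAction {H k A : ℕ} (hkH : k ≤ H) (hH : 0 < H)
    (o : LinearOrder (Fin A)) (S : ActionSet A) :
    1 ≤ (stayFactor H k : ENNReal) * exploreAction hkH o S (@Finset.max' _ o S.1 S.2) := by
  have h1 : (1 - k / (2 * H) : ENNReal) ≤
      exploreAction hkH o S (@Finset.max' _ o S.1 S.2) := by
    rw [exploreAction, PMF.ofFintype_apply, PMF.pure_apply, if_pos rfl, mul_one]
    exact le_add_self
  refine le_trans ?_ (mul_le_mul_right h1 _)
  have hH' : (0 : ℝ) < H := by exact_mod_cast hH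
  have ht : (k / H : ℝ) ≤ 1 := by rw [div_le_one hH']; exact_mod_cast hkH
  have ht0 : (0 : ℝ) ≤ k / H := by positivity
  have : (1 - k / (2 * H) : ENNReal) = ENNReal.ofReal (1 - k / H / 2) := by
    rw [ENNReal.ofReal_sub _ (by positivity), ENNReal.ofReal_one, div_div,
      ENNReal.ofReal_div_of_pos (by positivity), ENNReal.ofReal_mul (by positivity)]
    simp [mul_comm]
  rw [this, stayFactor]
  change 1 ≤ ENNReal.ofReal (Real.exp (k / H)) * _
  rw [← ENNReal.ofReal_mul (Real.exp_nonneg _), ENNReal.one_le_ofReal]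
  have := Real.add_one_le_exp (k / H : ℝ)
  nlinarith

/-- Changes the weight of a comparison from `q'` to `q * p`: multiply `hU` by `q * p / q'`, which is
at most `x`. If `q' = 0`, then `q * p = 0` as well, so states that are never reached do no harm. -/
theorem mul_mul_le_of_mul_le {q p x q' U W D : ENNReal} (h : q * p ≤ x * q') (hq' : q' ≠ ⊤)
    (hU : q' * U ≤ q' * W + D) : q * (p * U) ≤ q * (p * W) + x * D := by
  rw [← mul_assoc, ← mul_assoc]
  rcases eq_or_ne q' 0 with rfl | h0
  · have : q * p = 0 := by simpa using h
    simp [this]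
  · have hc : q * p / q' ≤ x := ENNReal.div_le_of_le_mul h
    have hqp : q * p = q * p / q' * q' := (ENNReal.div_mul_cancel h0 hq').symm
    calc q * p * U = q * p / q' * (q' * U) := by rw [← mul_assoc, ← hqp]
      _ ≤ q * p / q' * (q' * W + D) := mul_le_mul_right hU _
      _ = q * p * W + q * p / q' * D := by rw [mul_add, ← mul_assoc, ← hqp]
      _ ≤ _ := add_le_add_right (mul_le_mul_left hc _) _

namespace EpisodicMDP
variable {H k A : ℕ} {M : EpisodicMDP H k A}

theorem trans_eq_ofReal (i : Fin H) (l : Fin k) (a : Fin A) (s : Fin (k + 1)) :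
    M.trans i l a s = ENNReal.ofReal (M.transProb i l a s) := by
  have := M.isProbabilityMeasure_step
  rw [trans, transProb, ofReal_measureReal]

/-- Passing through `(l, i)` with action `a` is one of the ways in which exploration reaches `s`,
and `a` is played with probability at least `1 / uniformFactor`. -/
theorem reach_mul_trans_le (hk : 1 ≤ k) (hkH : k ≤ H)
    (ord : Fin H → Fin k → LinearOrder (Fin A)) (S : ActiveSets H k A) (i : Fin H) (l : Fin k)
    {a : Fin A} (ha : a ∈ (S i l).1) (s : Fin (k + 1)) :
    M.reach (exploreStrategy hkH ord S) i l.succ * M.trans i l a s ≤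
      uniformFactor H k A * M.reach (exploreStrategy hkH ord S) (i + 1) s := by
  rw [reach_succ]
  calc _ ≤ (uniformFactor H k A * exploreAction hkH (ord i l) (S i l) a) *
        (M.reach (exploreStrategy hkH ord S) i l.succ * M.trans i l a s) :=
        le_mul_of_one_le_left zero_le (le_uniformFactor_mul_exploreAction hk hkH _ _ ha)
    _ = uniformFactor H k A * (M.reach (exploreStrategy hkH ord S) i l.succ *
        (exploreAction hkH (ord i l) (S i l) a * M.trans i l a s)) := by ring
    _ ≤ _ := by
        refine mul_le_mul_right (le_trans (mul_le_mul_right ?_ _)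
          (Finset.single_le_sum (f := fun l : Fin k =>
            M.reach (exploreStrategy hkH ord S) i l.succ * ∑ a, exploreStrategy hkH ord S i l a * M.trans i l a s)
            (fun _ _ => zero_le) (Finset.mem_univ l))) _
        exact Finset.single_le_sum (f := fun b => exploreAction hkH (ord i l) (S i l) b *
          M.trans i l b s) (fun _ _ => zero_le) (Finset.mem_univ a)

/-- The place where the order on the actions enters: `a` may be replaced by the maximal active
action, which stays at least as often and which exploration almost always plays. -/
theorem reach_mul_trans_self_le (hkH : k ≤ H)
    {ord : Fin H → Fin k → LinearOrder (Fin A)} (hM : M.IsOrdered ord) (S : ActiveSets H k A)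
    (i : Fin H) (l : Fin k) {a : Fin A} (ha : a ∈ (S i l).1) :
    M.reach (exploreStrategy hkH ord S) i l.succ * M.trans i l a l.succ ≤
      stayFactor H k * M.reach (exploreStrategy hkH ord S) (i + 1) l.succ := by
  suffices ∀ t, t = l.succ → M.reach (exploreStrategy hkH ord S) i l.succ * M.trans i l a t ≤
      stayFactor H k * M.reach (exploreStrategy hkH ord S) (i + 1) t from this _ rfl
  intro t ht
  rw [reach_succ]
  set b := @Finset.max' _ (ord i l) (S i l).1 (S i l).2 with hb
  have hab : M.trans i l a t ≤ M.trans i l b t := by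
    rcases @lt_or_eq_of_le _ (ord i l).toPartialOrder _ _ (@Finset.le_max' _ (ord i l) _ _ ha)
      with h | h
    · rw [ht, trans_eq_ofReal, trans_eq_ofReal]
      exact ENNReal.ofReal_le_ofReal (hM.2 i l a _ h)
    · rw [h]
  calc _ ≤ (stayFactor H k * exploreAction hkH (ord i l) (S i l) b) *
        (M.reach (exploreStrategy hkH ord S) i l.succ * M.trans i l b t) :=
        (mul_le_mul_right hab _).trans
          (le_mul_of_one_le_left zero_le (le_stayFactor_mul_exploreAction hkH i.pos _ _))
    _ = stayFactor H k * (M.reach (exploreStrategy hkH ord S) i l.succ *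
        (exploreAction hkH (ord i l) (S i l) b * M.trans i l b t)) := by ring
    _ ≤ _ := by
        refine mul_le_mul_right (le_trans (mul_le_mul_right ?_ _)
          (Finset.single_le_sum (f := fun l : Fin k =>
            M.reach (exploreStrategy hkH ord S) i l.succ * ∑ a, exploreStrategy hkH ord S i l a * M.trans i l a t)
            (fun _ _ => zero_le) (Finset.mem_univ l))) _
        exact Finset.single_le_sum (f := fun b => exploreAction hkH (ord i l) (S i l) b *
          M.trans i l b t) (fun _ _ => zero_le) (Finset.mem_univ b)

/-- Propagation of weighted value differences by one stage. -/
theorem reach_mul_actionValue_le (hk : 1 ≤ k) (hkH : k ≤ H)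
    {ord : Fin H → Fin k → LinearOrder (Fin A)} (hM : M.IsOrdered ord) (S : ActiveSets H k A)
    (i : Fin H) (l : Fin k) {a : Fin A} (ha : a ∈ (S i l).1) {U W : Fin (k + 1) → ENNReal}
    (h0 : U 0 = 0) {D : ℕ → ENNReal}
    (h : ∀ s : Fin k, M.reach (exploreStrategy hkH ord S) (i + 1) s.succ * U s.succ ≤
      M.reach (exploreStrategy hkH ord S) (i + 1) s.succ * W s.succ + D s) :
    M.reach (exploreStrategy hkH ord S) i l.succ * M.actionValue i l a U ≤
      M.reach (exploreStrategy hkH ord S) i l.succ * M.actionValue i l a W +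
        (stayFactor H k * D l + uniformFactor H k A * ∑ s ∈ Finset.range l, D s) := by
  set q := M.reach (exploreStrategy hkH ord S) i l.succ
  have hterm : ∀ s : Fin k, q * (M.trans i l a s.succ * U s.succ) ≤
      q * (M.trans i l a s.succ * W s.succ) +
        ((if s = l then stayFactor H k * D l else 0) +
          if s < l then uniformFactor H k A * D s else 0) := by
    intro s
    rcases lt_trichotomy s l with hs | rfl | hs
    · rw [if_neg hs.ne, if_pos hs, zero_add]
      exact mul_mul_le_of_mul_le (reach_mul_trans_le hk hkH ord S i l ha _)
        (M.reach_ne_top _ _ _) (h s)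
    · rw [if_pos rfl, if_neg (lt_irrefl _), add_zero]
      exact mul_mul_le_of_mul_le (reach_mul_trans_self_le hkH hM S i s ha)
        (M.reach_ne_top _ _ _) (h s)
    · have : M.trans i l a s.succ = 0 := by
        rw [trans_eq_ofReal, hM.1 i l a _ (Fin.succ_lt_succ_iff.2 hs), ENNReal.ofReal_zero]
      rw [this, zero_mul, mul_zero]
      exact zero_le
  have hsum : ∑ s : Fin k, (if s < l then (uniformFactor H k A : ENNReal) * D s else 0) =
      uniformFactor H k A * ∑ s ∈ Finset.range l, D s := by
    rw [← Finset.sum_filter, ← Finset.mul_sum]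
    congr 1
    refine Finset.sum_bij (fun s _ => (s : ℕ)) ?_ ?_ ?_ ?_
    · intro s hs; simpa using hs
    · intro s _ t _ hst; exact Fin.ext hst
    · intro n hn
      have hn' := Finset.mem_range.1 hn
      exact ⟨⟨n, hn'.trans l.2⟩, Finset.mem_filter.2 ⟨Finset.mem_univ _, hn'⟩, rfl⟩
    · intro s _; rfl
  simp only [actionValue, mul_add q, Fin.sum_univ_succ, h0, mul_zero, zero_add]
  rw [add_assoc, Finset.mul_sum, Finset.mul_sum]
  refine add_le_add_right ?_ _
  calc _ ≤ ∑ s : Fin k, (q * (M.trans i l a s.succ * W s.succ) +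
        ((if s = l then stayFactor H k * D l else 0) +
          if s < l then uniformFactor H k A * D s else 0)) := Finset.sum_le_sum fun s _ => hterm s
    _ = ∑ s : Fin k, q * (M.trans i l a s.succ * W s.succ) +
        (stayFactor H k * D l + uniformFactor H k A * ∑ s ∈ Finset.range l, D s) := by
        rw [Finset.sum_add_distrib, Finset.sum_add_distrib, hsum, Finset.sum_ite_eq' Finset.univ l]
        simp
    -- Termination contributes nothing for `U`; for `W` its contribution is dropped.
    _ ≤ _ := add_le_add_left le_add_self _

/-! ### Accuracy of a phase -/

/-- The part of the mean test reward of action `a` in level `l` of stage `i` that depends on `a`. -/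
def testGain (M : EpisodicMDP H k A) (hkH : k ≤ H) (ord : Fin H → Fin k → LinearOrder (Fin A))
    (S : ActiveSets H k A) (α : Policy H k A) (i : Fin H) (l : Fin k) (a : Fin A) : ENNReal :=
  M.reach (exploreStrategy hkH ord S) i l.succ *
    M.actionValue i l a (M.valueFrom (pureStrategy α) (i + 1))

/-- The outcome of a phase in one state when all estimates are accurate. -/
structure IsAccurate (M : EpisodicMDP H k A) (hkH : k ≤ H)
    (ord : Fin H → Fin k → LinearOrder (Fin A)) (S : ActiveSets H k A) (ε : NNReal)
    (α : Policy H k A) (N : ActiveSets H k A) (i : Fin H) (l : Fin k) : Prop where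
  mem : α i l ∈ (S i l).1
  subset : (N i l).1 ⊆ (S i l).1
  best : ∀ a ∈ (S i l).1,
    M.testGain hkH ord S α i l a ≤ M.testGain hkH ord S α i l (α i l) + ε
  -- `d` will be the error inherited from later stages; the spare 1 absorbs the two estimation
  -- errors of `ε / 2`.
  keep : ∀ a ∈ (S i l).1, ∀ d : NNReal, d + 1 ≤ levelConst H k A (H - i) l →
    M.testGain hkH ord S α i l (α i l) ≤ M.testGain hkH ord S α i l a + d * ε → a ∈ (N i l).1
  near : ∀ a ∈ (N i l).1, M.testGain hkH ord S α i l (α i l) ≤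
    M.testGain hkH ord S α i l a + (levelConst H k A (H - i) l + 1) * ε

section Phase

variable {hkH : k ≤ H} {ord : Fin H → Fin k → LinearOrder (Fin A)} {S N : ActiveSets H k A}
  {ε : NNReal} {α : Policy H k A}

theorem coe_level_sum (c : ENNReal) (m l : ℕ) :
    (stayFactor H k : ENNReal) * (levelConst H k A m l * c) + uniformFactor H k A *
        ∑ s ∈ Finset.range l, levelConst H k A m s * c =
      ((stayFactor H k * levelConst H k A m l + uniformFactor H k A *
        ∑ s ∈ Finset.range l, levelConst H k A m s : NNReal) : ENNReal) * c := by
  push_cast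
  rw [← Finset.sum_mul]
  ring

/-- An optimal policy that uses active actions only survives an accurate phase, and the empirically
best policy is close to it. -/
theorem optimal_of_isAccurate (hk : 1 ≤ k) (hM : M.IsOrdered ord)
    (hacc : ∀ i l, M.IsAccurate hkH ord S ε α N i l) {π : Policy H k A}
    (hπ : ∀ i ≤ H, ∀ s, M.valueFrom (pureStrategy α) i s ≤ M.valueFrom (pureStrategy π) i s)
    (hS : ∀ i l, π i l ∈ (S i l).1) (i : ℕ) (hi : i ≤ H) :
    (∀ l : Fin k, M.reach (exploreStrategy hkH ord S) i l.succ *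
      M.valueFrom (pureStrategy π) i l.succ ≤ M.reach (exploreStrategy hkH ord S) i l.succ *
      M.valueFrom (pureStrategy α) i l.succ + levelConst H k A (H - i) l * ε) ∧
    ∀ j : Fin H, i ≤ j → ∀ l, π j l ∈ (N j l).1 := by
  refine backward_induction (P := fun i => (∀ l : Fin k,
    M.reach (exploreStrategy hkH ord S) i l.succ *
      M.valueFrom (pureStrategy π) i l.succ ≤ M.reach (exploreStrategy hkH ord S) i l.succ *
      M.valueFrom (pureStrategy α) i l.succ + levelConst H k A (H - i) l * ε) ∧
    ∀ j : Fin H, i ≤ j → ∀ l, π j l ∈ (N j l).1)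
    ⟨fun l => by simp [valueFrom_last], fun j hj => absurd j.2 (by omega)⟩ ?_ i hi
  rintro i ⟨ih1, ih2⟩
  have hm : H - (i : ℕ) = H - (i + 1) + 1 := by omega
  -- Keep the action of the optimal policy in stage `i`, but continue with `α`; the induction
  -- hypothesis pays for the change.
  have hstep : ∀ l : Fin k, M.reach (exploreStrategy hkH ord S) i l.succ *
      M.valueFrom (pureStrategy π) i l.succ ≤ M.testGain hkH ord S α i l (π i l) +
      ((stayFactor H k * levelConst H k A (H - (i + 1)) l + uniformFactor H k A *
        ∑ s ∈ Finset.range l, levelConst H k A (H - (i + 1)) s : NNReal) : ENNReal) * ε := by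
    intro l
    rw [← coe_level_sum, valueFrom_pure_succ]
    exact reach_mul_actionValue_le hk hkH hM S i l (hS i l) (M.valueFrom_zero _ _)
      (D := fun s => levelConst H k A (H - (i + 1)) s * ε) ih1
  have hα : ∀ l : Fin k, M.testGain hkH ord S α i l (α i l) =
      M.reach (exploreStrategy hkH ord S) i l.succ * M.valueFrom (pureStrategy α) i l.succ :=
    fun l => by rw [testGain, valueFrom_pure_succ]
  have hrec : ∀ l : Fin k, _ := fun l => levelConst_succ hk hkH (α i l).pos (H - (i + 1)) l
  refine ⟨fun l => ?_, fun j hj l => ?_⟩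
  · rw [← hα, hm]
    refine (hstep l).trans ((add_le_add_left ((hacc i l).best _ (hS i l)) _).trans ?_)
    rw [add_assoc]
    refine add_le_add_right ?_ _
    rw [← one_add_mul, add_comm]
    exact mul_le_mul_left (by exact_mod_cast hrec l) _
  · rcases Nat.eq_or_lt_of_le hj with hj | hj
    · obtain rfl : i = j := Fin.ext hj
      -- The optimal action survives: `α` is worth no more than the optimal policy, and hence little
      -- more than the optimal action followed by `α`.
      refine (hacc i l).keep _ (hS i l) _ (by rw [hm]; exact hrec l) ?_
      rw [hα]
      exact (mul_le_mul_right (hπ i i.2.le _) _).trans (hstep l)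
    · exact ih2 j hj l

/-- Policies that use refined actions only are close to the empirically best one. -/
theorem refined_of_isAccurate (hk : 1 ≤ k) (hM : M.IsOrdered ord)
    (hacc : ∀ i l, M.IsAccurate hkH ord S ε α N i l) {π : Policy H k A}
    (hN : ∀ i l, π i l ∈ (N i l).1) (i : ℕ) (hi : i ≤ H) :
    ∀ l : Fin k, M.reach (exploreStrategy hkH ord S) i l.succ *
      M.valueFrom (pureStrategy α) i l.succ ≤ M.reach (exploreStrategy hkH ord S) i l.succ *
      M.valueFrom (pureStrategy π) i l.succ +
        levelConst H k A (H - i) l * (2 * (H - i : ℕ) * ε) := by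
  refine backward_induction (P := fun i => ∀ l : Fin k,
    M.reach (exploreStrategy hkH ord S) i l.succ *
      M.valueFrom (pureStrategy α) i l.succ ≤ M.reach (exploreStrategy hkH ord S) i l.succ *
      M.valueFrom (pureStrategy π) i l.succ +
        levelConst H k A (H - i) l * (2 * (H - i : ℕ) * ε))
    (fun l => by simp [valueFrom_last]) ?_ i hi
  intro i ih l
  have hm : H - (i : ℕ) = H - (i + 1) + 1 := by omega
  have h1 := reach_mul_actionValue_le hk hkH hM S i l ((hacc i l).subset (hN i l))
    (M.valueFrom_zero _ _)
    (D := fun s => levelConst H k A (H - (i + 1)) s * (2 * (H - (i + 1) : ℕ) * ε)) ih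
  have h2 := (hacc i l).near _ (hN i l)
  rw [coe_level_sum] at h1
  have hrec := levelConst_succ hk hkH (α i l).pos (H - (i + 1)) l
  have hone := one_le_levelConst hk hkH (α i l).pos (m := H - i) (by omega) l
  rw [valueFrom_pure_succ, valueFrom_pure_succ]
  refine h2.trans ((add_le_add_left h1 _).trans ?_)
  rw [add_assoc]
  refine add_le_add_right ?_ _
  rw [← hm] at hrec
  set C := levelConst H k A (H - i) l
  set E := stayFactor H k * levelConst H k A (H - (i + 1)) l + uniformFactor H k A *
        ∑ s ∈ Finset.range l, levelConst H k A (H - (i + 1)) s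
  -- A surviving action of this stage costs `C + 1 ≤ 2 * C`, and each later stage costs at most `2 *
  -- C`, since `E ≤ C`.
  have : E * (2 * (H - (i + 1) : ℕ)) + (C + 1) ≤ C * (2 * (H - i : ℕ)) := by
    rw [hm]
    rw [Nat.cast_add_one]
    generalize ((H - (i + 1) : ℕ) : NNReal) = m
    calc E * (2 * m) + (C + 1) ≤ C * (2 * m) + (C + C) := by
          gcongr
          exact le_self_add.trans hrec
      _ = C * (2 * (m + 1)) := by ring
  calc _ = ((E * (2 * (H - (i + 1) : ℕ)) + (C + 1) : NNReal) : ENNReal) * ε := by push_cast; ring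
    _ ≤ ((C * (2 * (H - i : ℕ)) : NNReal) : ENNReal) * ε := by gcongr
    _ = _ := by push_cast; ring

end Phase

/-- The value of a policy, as an extended non-negative real. -/
def totalValue (M : EpisodicMDP H k A) (π : Policy H k A) : ENNReal :=
  M.valueFrom (pureStrategy π) 0 (Fin.last k)

/-- The suboptimality, in units of the accuracy, of policies that pass a phase. -/
def phaseLoss (H k A : ℕ) : NNReal := 3 * H * levelConst H k A H (k - 1)

/-- The start state is reached with probability one, so the weights disappear there. The losses `C`
(optimal to `α`) and `2 * H * C` (`α` to `ρ`) add up to at most `3 * H * C`. -/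
theorem totalValue_le_of_isAccurate (hk : 1 ≤ k) {hkH : k ≤ H}
    {ord : Fin H → Fin k → LinearOrder (Fin A)} (hM : M.IsOrdered ord) {S N : ActiveSets H k A}
    {ε : NNReal} {α : Policy H k A}
    (hacc : ∀ i l, M.IsAccurate hkH ord S ε α N i l) {π ρ : Policy H k A}
    (hπ : ∀ i ≤ H, ∀ s, M.valueFrom (pureStrategy α) i s ≤ M.valueFrom (pureStrategy π) i s)
    (hS : ∀ i l, π i l ∈ (S i l).1) (hN : ∀ i l, ρ i l ∈ (N i l).1) :
    M.totalValue π ≤ M.totalValue ρ + phaseLoss H k A * ε := by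
  have hl : (⟨k - 1, by omega⟩ : Fin k).succ = Fin.last k := by ext; simp; omega
  have h1 := (optimal_of_isAccurate hk hM hacc hπ hS 0 (Nat.zero_le _)).1 ⟨k - 1, by omega⟩
  have h2 := refined_of_isAccurate hk hM hacc hN 0 (Nat.zero_le _) ⟨k - 1, by omega⟩
  simp only [hl, reach, if_pos, one_mul, Nat.sub_zero] at h1 h2
  refine h1.trans ((add_le_add_left h2 _).trans ?_)
  rw [add_assoc]
  refine add_le_add_right ?_ _
  have hH : (1 : NNReal) ≤ H := by exact_mod_cast hk.trans hkH
  rw [phaseLoss]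
  set C := levelConst H k A H (k - 1)
  calc _ = ((C * (2 * H + 1) : NNReal) : ENNReal) * ε := by push_cast; ring
    _ ≤ ((3 * H * C : NNReal) : ENNReal) * ε := by
        refine mul_le_mul_left (ENNReal.coe_le_coe.2 ?_) _
        calc C * (2 * H + 1) ≤ C * (2 * H + H) := by gcongr
          _ = 3 * H * C := by ring

end EpisodicMDP

/-! ### Values of normalized MDPs -/

namespace EpisodicMDP
variable {H k A : ℕ} {M : EpisodicMDP H k A}

theorem IsNormalized.ae_mem_Icc (hM : M.IsNormalized) (π : Policy H k A) :
    ∀ᵐ x ∂(M.rewardLaw π), x ∈ Set.Icc (0 : ℝ) 1 := by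
  filter_upwards [M.tailLaw_nonneg hM.1 π H le_rfl (Fin.last k), hM.2 π] with x h1 h2
    using ⟨h1, h2⟩

theorem lintegral_rewardLaw (hM : M.IsNormalized) (π : Policy H k A) :
    ∫⁻ x, ENNReal.ofReal x ∂(M.rewardLaw π) = M.totalValue π :=
  M.lintegral_tailLaw hM.1 π H le_rfl (Fin.last k)

theorem value_eq_toReal (hM : M.IsNormalized) (π : Policy H k A) :
    M.value π = (M.totalValue π).toReal := by
  rw [value, integral_eq_lintegral_of_nonneg_ae
    ((hM.ae_mem_Icc π).mono fun x hx => hx.1) aestronglyMeasurable_id, ← lintegral_rewardLaw hM]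

theorem totalValue_le_one (hM : M.IsNormalized) (π : Policy H k A) : M.totalValue π ≤ 1 := by
  rw [← lintegral_rewardLaw hM]
  calc _ ≤ ∫⁻ _, 1 ∂(M.rewardLaw π) := lintegral_mono_ae <| by
        filter_upwards [hM.ae_mem_Icc π] with x hx using ENNReal.ofReal_le_one.2 hx.2
    _ = 1 := by simp

theorem ofReal_value (hM : M.IsNormalized) (π : Policy H k A) :
    ENNReal.ofReal (M.value π) = M.totalValue π := by
  rw [value_eq_toReal hM, ENNReal.ofReal_toReal
    ((totalValue_le_one hM π).trans_lt ENNReal.one_lt_top).ne]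

theorem value_nonneg (hM : M.IsNormalized) (π : Policy H k A) : 0 ≤ M.value π := by
  rw [value_eq_toReal hM]; exact ENNReal.toReal_nonneg

theorem value_le_one (hM : M.IsNormalized) (π : Policy H k A) : M.value π ≤ 1 := by
  rw [← ENNReal.ofReal_le_one, ofReal_value hM]; exact totalValue_le_one hM π

/-- The loss of a policy compared to the optimum. -/
def gap (M : EpisodicMDP H k A) (π : Policy H k A) : ENNReal := ENNReal.ofReal (M.opt - M.value π)

theorem gap_le_one [NeZero A] (hM : M.IsNormalized) (π : Policy H k A) : M.gap π ≤ 1 := by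
  rw [gap, ENNReal.ofReal_le_one]
  have : M.opt ≤ 1 := ciSup_le fun ρ => value_le_one hM ρ
  linarith [value_nonneg hM π]

theorem gap_le_of_totalValue_le [NeZero A] (hM : M.IsNormalized) {π ρ : Policy H k A}
    (hπ : ∀ σ, M.totalValue σ ≤ M.totalValue π) {d : NNReal}
    (h : M.totalValue π ≤ M.totalValue ρ + d) : M.gap ρ ≤ d := by
  rw [gap, ← ENNReal.ofReal_coe_nnreal]
  refine ENNReal.ofReal_le_ofReal ?_
  rw [sub_le_iff_le_add']
  refine ciSup_le fun σ => ?_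
  refine (ENNReal.ofReal_le_ofReal_iff (add_nonneg (value_nonneg hM ρ) d.coe_nonneg)).1 ?_
  rw [ENNReal.ofReal_add (value_nonneg hM ρ) d.coe_nonneg, ofReal_value hM, ofReal_value hM,
    ENNReal.ofReal_coe_nnreal]
  exact (hπ σ).trans h

/-! ### The reward of a random policy -/

/-- The law of the reward of a random policy. -/
def mixLaw (M : EpisodicMDP H k A) (μ : PMF (Policy H k A)) : Measure ℝ :=
  ∑ π, μ π • M.rewardLaw π

/-- The expected reward of a random policy. -/
def mixValue (M : EpisodicMDP H k A) (μ : PMF (Policy H k A)) : ℝ := ∫ x, x ∂(M.mixLaw μ)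

theorem lintegral_mixLaw (μ : PMF (Policy H k A)) (f : ℝ → ENNReal) :
    ∫⁻ x, f x ∂(M.mixLaw μ) = ∑ π, μ π * ∫⁻ x, f x ∂(M.rewardLaw π) := by
  rw [mixLaw, lintegral_finsetSum_measure]
  simp only [lintegral_smul_measure, smul_eq_mul]

instance (μ : PMF (Policy H k A)) : IsProbabilityMeasure (M.mixLaw μ) := by
  refine ⟨?_⟩
  rw [← lintegral_one, lintegral_mixLaw]
  simp [PMF_sum_coe]

theorem ae_mixLaw (hM : M.IsNormalized) (μ : PMF (Policy H k A)) :
    ∀ᵐ x ∂(M.mixLaw μ), x ∈ Set.Icc (0 : ℝ) 1 := by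
  rw [mixLaw, ae_iff, Measure.finsetSum_apply]
  refine Finset.sum_eq_zero fun π _ => ?_
  rw [Measure.smul_apply, ae_iff.1 (hM.ae_mem_Icc π), smul_zero]

theorem mixValue_nonneg (hM : M.IsNormalized) (μ : PMF (Policy H k A)) : 0 ≤ M.mixValue μ :=
  integral_nonneg_of_ae ((ae_mixLaw hM μ).mono fun _ hx => hx.1)

theorem ofReal_mixValue (hM : M.IsNormalized) (μ : PMF (Policy H k A)) :
    ENNReal.ofReal (M.mixValue μ) = ∑ π, μ π * M.totalValue π := by
  rw [mixValue, ofReal_integral_eq_lintegral_ofReal (f := fun x : ℝ => x)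
    (Integrable.of_mem_Icc 0 1 aemeasurable_id (ae_mixLaw hM μ))
    ((ae_mixLaw hM μ).mono fun _ hx => hx.1), lintegral_mixLaw]
  exact Finset.sum_congr rfl fun π _ => by rw [lintegral_rewardLaw hM]

theorem ofReal_mixValue_productPolicy (hM : M.IsNormalized) (σ : Strategy H k A) :
    ENNReal.ofReal (M.mixValue (productPolicy σ)) = M.valueFrom σ 0 (Fin.last k) := by
  rw [ofReal_mixValue hM]
  exact M.sum_productPolicy_valueFrom σ 0 (Nat.zero_le _) _

/-- Hoeffding's lemma for rewards in `[0, 1]`: the variance proxy is `(1/2)^2`. -/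
theorem lintegral_exp_mixLaw_le (hM : M.IsNormalized) (μ : PMF (Policy H k A)) (t : ℝ) :
    ∫⁻ x, ENNReal.ofReal (Real.exp (t * x)) ∂(M.mixLaw μ) ≤
      ENNReal.ofReal (Real.exp (t * M.mixValue μ + t ^ 2 / 8)) := by
  have h := ProbabilityTheory.hasSubgaussianMGF_of_mem_Icc (μ := M.mixLaw μ) (X := fun x => x)
    aemeasurable_id (ae_mixLaw hM μ)
  change ProbabilityTheory.HasSubgaussianMGF (fun x => x - M.mixValue μ) _ _ at h
  have h1 := h.mgf_le t
  have h2 := h.integrable_exp_mul t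
  have h3 : ∀ x : ℝ, Real.exp (t * x) =
      Real.exp (t * M.mixValue μ) * Real.exp (t * (x - M.mixValue μ)) := fun x => by
    rw [← Real.exp_add]; ring_nf
  rw [lintegral_congr fun x => congrArg ENNReal.ofReal (h3 x),
    ← ofReal_integral_eq_lintegral_ofReal (h2.const_mul _)
    (Filter.Eventually.of_forall fun x => by positivity), integral_const_mul, Real.exp_add]
  refine ENNReal.ofReal_le_ofReal (mul_le_mul_of_nonneg_left (h1.trans ?_) (Real.exp_nonneg _))
  refine Real.exp_le_exp.2 (le_of_eq ?_)
  have h4 : (((‖(1 : ℝ) - 0‖₊ / 2) ^ 2 : NNReal) : ℝ) = 1 / 4 := by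
    rw [sub_zero, nnnorm_one, NNReal.coe_pow, NNReal.coe_div, NNReal.coe_one, NNReal.coe_ofNat]
    norm_num
  rw [h4]
  ring

/-! ### The regret of programs -/

open BanditProg

/-- The expected regret over `n` episodes of following a program. -/
def cost (M : EpisodicMDP H k A) (prog : BanditProg (Policy H k A) (Policy H k A)) (n : ℕ) :
    ENNReal := M.expectedRegret n prog.act

/-- The crude bound that is paid after an inaccurate estimate. -/
theorem expectedRegret_le [NeZero A] (hM : M.IsNormalized) (n : ℕ) (alg : OnlineAlgorithm H k A) :
    M.expectedRegret n alg ≤ n := by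
  induction n generalizing alg with
  | zero => simp [expectedRegret]
  | succ n ih =>
    rw [expectedRegret]
    calc _ ≤ ∑ π, alg [] π * (1 + n) := by
          refine Finset.sum_le_sum fun π _ => mul_le_mul_right (add_le_add (gap_le_one hM π) ?_) _
          refine (lintegral_mono fun x => ih _).trans ?_
          simp
      _ = _ := by rw [← Finset.sum_mul, PMF_sum_coe, one_mul]; push_cast; ring

theorem cost_ret (π : Policy H k A) (n : ℕ) : M.cost (ret π) n = n * M.gap π := by
  have : ∀ x : ℝ, (fun h => (ret π : BanditProg (Policy H k A) (Policy H k A)).act ((π, x) :: h)) =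
      (ret π : BanditProg (Policy H k A) (Policy H k A)).act := fun x => by funext h; simp [act]
  induction n with
  | zero => simp [cost, expectedRegret]
  | succ n ih =>
    rw [cost, expectedRegret]
    have h0 : (ret π : BanditProg (Policy H k A) (Policy H k A)).act [] = PMF.pure π := by
      simp [act]
    rw [h0]
    rw [Finset.sum_eq_single π]
    · simp only [this]
      rw [cost] at ih
      rw [ih]
      simp [gap]
      ring
    · intro ρ _ h; simp [PMF.pure_apply, h]
    · simp

/-- The continuation sees the reward but not the policy drawn, so averaging over the policies turns
the feedback into a sample of `mixLaw`. Only policies in the support of `μ` need a small gap. -/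
theorem cost_play_le {μ : PMF (Policy H k A)}
    {next : ℝ → BanditProg (Policy H k A) (Policy H k A)} {n : ℕ} {δ : ENNReal}
    {g : ℝ → ENNReal} (hδ : ∀ π, μ π ≠ 0 → M.gap π ≤ δ) (hg : ∀ x, M.cost (next x) n ≤ g x) :
    M.cost (play μ next) (n + 1) ≤ δ + ∫⁻ x, g x ∂(M.mixLaw μ) := by
  have hact : ∀ (π : Policy H k A) (x : ℝ), (fun h => (play μ next).act ((π, x) :: h)) =
      (next x).act := fun π x => by funext h; rw [act]
  rw [cost, expectedRegret, lintegral_mixLaw]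
  simp only [hact]
  have : (play μ next).act [] = μ := by rw [act]
  rw [this]
  calc _ ≤ ∑ π, (μ π * δ + μ π * ∫⁻ x, g x ∂(M.rewardLaw π)) := by
        refine Finset.sum_le_sum fun π _ => ?_
        rcases eq_or_ne (μ π) 0 with h | h
        · simp [h]
        · rw [← mul_add]
          exact mul_le_mul_right (add_le_add (hδ π h) (lintegral_mono fun x => hg x)) _
    _ = _ := by rw [Finset.sum_add_distrib, ← Finset.sum_mul, PMF_sum_coe, one_mul]

theorem prog_bind_assoc {P α β γ : Type} (p : BanditProg P α) (f : α → BanditProg P β)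
    (g : β → BanditProg P γ) :
    (p.bind f).bind g = p.bind fun a => (f a).bind g := by
  induction p with
  | ret a => rfl
  | play μ next ih =>
    simp only [BanditProg.bind]
    congr 1
    funext x
    exact ih x

/-- With an additional regret of at most `D` (over a horizon of at most `T` episodes, and including
the regret after a failure), the program returns a value with property `Q`. -/
def Guarantee (M : EpisodicMDP H k A) (T : ℕ) {α : Type} (prog : BanditProg (Policy H k A) α)
    (D : ENNReal) (Q : α → Prop) : Prop :=
  ∀ (f : α → BanditProg (Policy H k A) (Policy H k A)) (c : ENNReal),
    (∀ a, Q a → ∀ m ≤ T, M.cost (f a) m ≤ c) → ∀ m ≤ T, M.cost (prog.bind f) m ≤ D + c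

theorem Guarantee.ret {T : ℕ} {α : Type} {a : α} {D : ENNReal} {Q : α → Prop} (h : Q a) :
    M.Guarantee T (.ret a : BanditProg (Policy H k A) α) D Q :=
  fun _ _ hf m hm => (hf a h m hm).trans le_add_self

/-- Since the regret after a failure is included in `D`, no union bound over failures is needed. -/
theorem Guarantee.bind {T : ℕ} {α β : Type} {prog : BanditProg (Policy H k A) α}
    {g : α → BanditProg (Policy H k A) β} {D₁ D₂ : ENNReal} {Q₁ : α → Prop} {Q₂ : β → Prop}
    (h₁ : M.Guarantee T prog D₁ Q₁) (h₂ : ∀ a, Q₁ a → M.Guarantee T (g a) D₂ Q₂) :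
    M.Guarantee T (prog.bind g) (D₁ + D₂) Q₂ := by
  intro f c hf m hm
  rw [prog_bind_assoc, add_assoc]
  exact h₁ _ _ (fun a ha => h₂ a ha f c hf) m hm

theorem Guarantee.mono {T : ℕ} {α : Type} {prog : BanditProg (Policy H k A) α}
    {D D' : ENNReal} {Q Q' : α → Prop} (h : M.Guarantee T prog D Q) (hD : D ≤ D')
    (hQ : ∀ a, Q a → Q' a) : M.Guarantee T prog D' Q' :=
  fun f c hf m hm => (h f c (fun a ha => hf a (hQ a ha)) m hm).trans (add_le_add_left hD _)

/-- Exponential weights. -/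
def expWeight (t x : ℝ) : ENNReal := ENNReal.ofReal (Real.exp (t * x))

theorem expWeight_add (t x y : ℝ) : expWeight t (x + y) = expWeight t x * expWeight t y := by
  rw [expWeight, expWeight, expWeight, ← ENNReal.ofReal_mul (Real.exp_nonneg _), ← Real.exp_add,
    mul_add]

theorem measurable_expWeight (t : ℝ) : Measurable (expWeight t) := by
  unfold expWeight
  fun_prop

/-- A bound by a constant plus two exponentials of the running sum, one for each tail, keeps its
form when an episode is played: each exponential picks up one factor of its moment generating
function. -/
theorem cost_sumRewards_le {μ : PMF (Policy H k A)} {δ : ENNReal}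
    (hδ : ∀ π, μ π ≠ 0 → M.gap π ≤ δ) {T : ℕ}
    (f : ℝ → BanditProg (Policy H k A) (Policy H k A)) {c κ₁ κ₂ : ENNReal} {t₁ t₂ : ℝ}
    (hf : ∀ s, ∀ m ≤ T, M.cost (f s) m ≤ c + κ₁ * expWeight t₁ s + κ₂ * expWeight t₂ s)
    (n : ℕ) (acc : ℝ) (m : ℕ) (hm : m ≤ T) :
    M.cost ((sumRewards μ n acc).bind f) m ≤ n * δ +
      (c + κ₁ * expWeight t₁ acc * (∫⁻ x, expWeight t₁ x ∂(M.mixLaw μ)) ^ n +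
        κ₂ * expWeight t₂ acc * (∫⁻ x, expWeight t₂ x ∂(M.mixLaw μ)) ^ n) := by
  induction n generalizing acc m with
  | zero =>
    simp only [sumRewards, BanditProg.bind, Nat.cast_zero, zero_mul, zero_add, pow_zero, mul_one]
    exact hf acc m hm
  | succ n ih =>
    simp only [sumRewards, BanditProg.bind]
    cases m with
    -- The horizon may end in the middle of an average; then no further regret arises.
    | zero => simp [cost, expectedRegret]
    | succ m =>
      refine (cost_play_le hδ fun x => ih (acc + x) m (by omega)).trans ?_
      simp only [expWeight_add]
      generalize hE₁ : ∫⁻ x, expWeight t₁ x ∂(M.mixLaw μ) = E₁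
      generalize hE₂ : ∫⁻ x, expWeight t₂ x ∂(M.mixLaw μ) = E₂
      have h1 : ∀ x, n * δ + (c + κ₁ * (expWeight t₁ acc * expWeight t₁ x) * E₁ ^ n +
          κ₂ * (expWeight t₂ acc * expWeight t₂ x) * E₂ ^ n) =
          (n * δ + c) + ((κ₁ * expWeight t₁ acc * E₁ ^ n) * expWeight t₁ x +
          (κ₂ * expWeight t₂ acc * E₂ ^ n) * expWeight t₂ x) := fun x => by ring
      simp only [h1]
      rw [lintegral_add_left measurable_const,
        lintegral_add_left ((measurable_expWeight _).const_mul _),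
        lintegral_const_mul _ (measurable_expWeight _),
        lintegral_const_mul _ (measurable_expWeight _), hE₁, hE₂]
      simp only [lintegral_const, measure_univ, mul_one]
      refine le_of_eq ?_
      push_cast
      ring

theorem two_mul_mul_exp_neg_le_one {T : ℕ} (hT : 2 ≤ T) {u : ℝ} (hu : 6 * Real.log T ≤ u) :
    2 * (T * Real.exp (-u)) ≤ 1 := by
  have hT' : (2 : ℝ) ≤ T := by exact_mod_cast hT
  have hT0 : (0 : ℝ) < T := by linarith
  have h1 : Real.exp (-u) ≤ ((T : ℝ) ^ 6)⁻¹ := by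
    rw [Real.exp_neg]
    refine inv_anti₀ (by positivity) ?_
    calc (T : ℝ) ^ 6 = Real.exp (6 * Real.log T) := by
          rw [← Real.exp_log (pow_pos hT0 6), Real.log_pow]; norm_num
      _ ≤ _ := Real.exp_le_exp.2 hu
  have h2 : (2 : ℝ) * T ≤ (T : ℝ) ^ 6 := by
    calc (2 : ℝ) * T ≤ T * T := by gcongr
      _ = (T : ℝ) ^ 2 := by ring
      _ ≤ (T : ℝ) ^ 6 := pow_le_pow_right₀ (by linarith) (by norm_num)
  calc 2 * (T * Real.exp (-u)) ≤ 2 * (T * ((T : ℝ) ^ 6)⁻¹) := by gcongr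
    _ = (2 * T) / (T : ℝ) ^ 6 := by ring
    _ ≤ 1 := by rw [div_le_one (by positivity)]; exact h2

/-- Averages of sufficiently many rewards are accurate. -/
theorem guarantee_sampleMean [NeZero A] (hM : M.IsNormalized) {T : ℕ} (hT : 2 ≤ T)
    {μ : PMF (Policy H k A)} {δ : ENNReal} (hδ : ∀ π, μ π ≠ 0 → M.gap π ≤ δ) {n : ℕ} {ε : ℝ}
    (hε : 0 < ε) (hn : 12 * Real.log T ≤ n * ε ^ 2) :
    M.Guarantee T (sampleMean μ n) (n * δ + 1) fun m => |m - M.mixValue μ| ≤ ε / 2 := by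
  intro f c hf m hm
  set Φ := M.mixValue μ
  have hT' : (2 : ℝ) ≤ T := by exact_mod_cast hT
  have hn0 : (0 : ℝ) < n := by
    have := Real.log_pos (by linarith : (1 : ℝ) < T)
    by_contra h
    have : (n : ℝ) * ε ^ 2 ≤ 0 := mul_nonpos_of_nonpos_of_nonneg (not_lt.1 h) (by positivity)
    linarith
  rw [sampleMean, prog_bind_assoc]
  simp only [BanditProg.bind]
  -- Chernoff's method with the optimal exponents `±2ε` for a deviation of `ε / 2`. The prefactors
  -- make each weight equal to `T` when the sum deviates by exactly `n * (ε / 2)`.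
  have key := cost_sumRewards_le (M := M) hδ (T := T) (fun s => f (s / n)) (c := c)
    (κ₁ := T * expWeight (2 * ε) (-(n * Φ + n * (ε / 2))))
    (κ₂ := T * expWeight (-(2 * ε)) (-(n * Φ - n * (ε / 2)))) (t₁ := 2 * ε) (t₂ := -(2 * ε)) ?_
    n 0 m hm
  · refine key.trans ?_
    rw [add_assoc, add_assoc]
    refine add_le_add_right ?_ _
    rw [add_comm 1 c]
    refine add_le_add_right ?_ _
    -- Each tail costs `T * exp (-n ε² / 2)`, which is at most `T ^ (-5)` by the choice of `n`.
    have hb : ∀ t b : ℝ, t * b + n * (t * Φ + t ^ 2 / 8) = -(n * ε ^ 2 / 2) →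
        T * expWeight t b * expWeight t 0 *
          (∫⁻ x, expWeight t x ∂(M.mixLaw μ)) ^ n ≤
          ENNReal.ofReal (T * Real.exp (-(n * ε ^ 2 / 2))) := by
      intro t b htb
      calc _ ≤ T * expWeight t b * expWeight t 0 *
            (ENNReal.ofReal (Real.exp (t * M.mixValue μ + t ^ 2 / 8))) ^ n := by
            gcongr
            exact lintegral_exp_mixLaw_le hM μ t
        _ = _ := by
            rw [expWeight, expWeight, mul_zero, Real.exp_zero, ENNReal.ofReal_one, mul_one,
              ← ENNReal.ofReal_pow (Real.exp_nonneg _), ← Real.exp_nat_mul, mul_assoc,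
              ← ENNReal.ofReal_mul (Real.exp_nonneg _), ← Real.exp_add, htb,
              ENNReal.ofReal_mul (by positivity), ENNReal.ofReal_natCast]
    refine (add_le_add (hb _ _ (by ring)) (hb _ _ (by ring))).trans ?_
    rw [← ENNReal.ofReal_add (by positivity) (by positivity), ← two_mul, ENNReal.ofReal_le_one]
    exact two_mul_mul_exp_neg_le_one hT (by linarith)
  · intro s m hm
    -- On a good outcome the continuation costs `c`; otherwise it costs at most `T`, and one of the
    -- two weights is at least `T`.
    by_cases hs : |s / n - Φ| ≤ ε / 2
    · exact (hf _ hs m hm).trans (by rw [add_assoc]; exact le_self_add)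
    · have hcost : M.cost (f (s / n)) m ≤ T :=
        (expectedRegret_le hM m _).trans (by exact_mod_cast hm)
      have hw : ∀ t b : ℝ, 0 ≤ t * (b + s) → (T : ENNReal) ≤ T * expWeight t b * expWeight t s := by
        intro t b htb
        rw [mul_assoc, ← expWeight_add]
        refine le_mul_of_one_le_right zero_le ?_
        rw [expWeight, ENNReal.one_le_ofReal]
        exact Real.one_le_exp htb
      have hsn : s / n * n = s := div_mul_cancel₀ _ hn0.ne'
      rcases lt_abs.1 (not_le.1 hs) with h | h
      · refine hcost.trans ((hw _ _ ?_).trans (le_add_self.trans le_self_add))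
        have := mul_lt_mul_of_pos_right h hn0
        refine mul_nonneg (by linarith) ?_
        rw [sub_mul, hsn] at this
        linarith
      · refine hcost.trans ((hw _ _ ?_).trans le_add_self)
        have := mul_lt_mul_of_pos_right h hn0
        refine mul_nonneg_of_nonpos_of_nonpos (by linarith) ?_
        rw [neg_mul, sub_mul, hsn] at this
        linarith

theorem guarantee_estimate [NeZero A] (hM : M.IsNormalized) {T : ℕ} (hT : 2 ≤ T)
    {μ : Fin A → PMF (Policy H k A)} {δ : ENNReal} {n : ℕ} {ε : ℝ}
    (hε : 0 < ε) (hn : 12 * Real.log T ≤ n * ε ^ 2) (as : List (Fin A))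
    (hδ : ∀ a ∈ as, ∀ π, μ a π ≠ 0 → M.gap π ≤ δ) :
    M.Guarantee T (estimate μ n as) (as.length * (n * δ + 1))
      fun Φ => ∀ a ∈ as, |Φ a - M.mixValue (μ a)| ≤ ε / 2 := by
  induction as with
  | nil => exact Guarantee.ret (by simp)
  | cons a as ih =>
    rw [estimate]
    have := Guarantee.bind (guarantee_sampleMean hM hT (hδ a (by simp)) hε hn) fun m hm =>
      Guarantee.bind (ih fun b hb => hδ b (by simp [hb])) fun Φ hΦ =>
        Guarantee.ret (M := M) (T := T) (a := Function.update Φ a m) (D := 0)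
          (Q := fun Φ => ∀ b ∈ a :: as, |Φ b - M.mixValue (μ b)| ≤ ε / 2) (by
            intro b hb
            rcases eq_or_ne b a with rfl | h
            · rw [Function.update_self]; exact hm
            · rw [Function.update_of_ne h]
              exact hΦ b ((List.mem_cons.1 hb).resolve_left h))
    refine this.mono (le_of_eq ?_) fun _ h => h
    rw [List.length_cons]
    push_cast
    ring

end EpisodicMDP

/-! ### One phase -/

theorem ActionSet.le_argmax {A : ℕ} (S : ActionSet A) (f : Fin A → ℝ) {b : Fin A} (hb : b ∈ S.1) :
    f b ≤ f (S.argmax f) :=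
  (Finset.mem_filter.1 (Finset.min'_mem (S.1.filter fun a => ∀ b ∈ S.1, f b ≤ f a) _)).2 b hb

theorem ActionSet.mem_refine {A : ℕ} (S : ActionSet A) (f : Fin A → ℝ) (δ : NNReal) {a : Fin A} :
    a ∈ (S.refine f δ).1 ↔ a ∈ S.1 ∧ f (S.argmax f) - δ ≤ f a :=
  Finset.mem_filter

theorem mem_of_exploreAction_ne_zero {H k A : ℕ} {hkH : k ≤ H} {o : LinearOrder (Fin A)}
    {S : ActionSet A} {a : Fin A} (h : exploreAction hkH o S a ≠ 0) : a ∈ S.1 := by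
  by_contra ha
  refine h ?_
  rw [exploreAction, PMF.ofFintype_apply, PMF.uniformOfFinset_apply_of_notMem _ ha,
    PMF.pure_apply, if_neg]
  · simp
  · rintro rfl
    exact ha (@Finset.max'_mem _ o _ _)

theorem apply_ne_zero_of_productPolicy_ne_zero {H k A : ℕ} {σ : Strategy H k A}
    {π : Policy H k A} (h : productPolicy σ π ≠ 0) (i : Fin H) (l : Fin k) :
    σ i l (π i l) ≠ 0 := by
  rw [productPolicy, PMF.ofFintype_apply] at h
  exact Finset.prod_ne_zero_iff.1 (Finset.prod_ne_zero_iff.1 h i (Finset.mem_univ _)) l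
    (Finset.mem_univ _)

theorem eq_of_pure_apply_ne_zero {α : Type*} {a b : α} (h : PMF.pure a b ≠ 0) : b = a := by
  simpa using (PMF.mem_support_iff _ _).2 h

/-- Every policy that a phase plays uses active actions only, so its regret is controlled by the
preceding phase. -/
theorem mem_of_testPolicy_ne_zero {H k A : ℕ} {hkH : k ≤ H}
    {ord : Fin H → Fin k → LinearOrder (Fin A)} {S : ActiveSets H k A} {α : Policy H k A}
    {i : Fin H} {l : Fin k} {a : Fin A} (hα : ∀ j, i < j → ∀ s, α j s ∈ (S j s).1)
    (ha : a ∈ (S i l).1) {π : Policy H k A} (h : testPolicy hkH ord S α i l a π ≠ 0) (j : Fin H)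
    (s : Fin k) : π j s ∈ (S j s).1 := by
  have := apply_ne_zero_of_productPolicy_ne_zero h j s
  split_ifs at this with h1 h2
  · rw [eq_of_pure_apply_ne_zero this]
    exact hα j h1 s
  · rw [eq_of_pure_apply_ne_zero this, h2.1, h2.2]
    exact ha
  · exact mem_of_exploreAction_ne_zero this

namespace EpisodicMDP
variable {H k A : ℕ} {M : EpisodicMDP H k A}

/-- The mean test rewards differ from the test gains by a constant. -/
theorem exists_mixValue_testPolicy_eq (hM : M.IsNormalized) (hkH : k ≤ H)
    (ord : Fin H → Fin k → LinearOrder (Fin A)) (S : ActiveSets H k A) (α : Policy H k A)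
    (i : Fin H) (l : Fin k) : ∃ B : ENNReal, ∀ a,
      ENNReal.ofReal (M.mixValue (testPolicy hkH ord S α i l a)) =
        B + M.testGain hkH ord S α i l a := by
  -- The constant consists of the reward before stage `i` and the contribution of the other levels
  -- of stage `i`; neither depends on `a`.
  refine ⟨M.gained (exploreStrategy hkH ord S) i + ∑ s ∈ Finset.univ.erase l,
    M.reach (exploreStrategy hkH ord S) i s.succ *
      ∑ b, exploreStrategy hkH ord S i s b *
        M.actionValue i s b (M.valueFrom (pureStrategy α) (i + 1)), fun a => ?_⟩
  rw [testPolicy, ofReal_mixValue_productPolicy hM]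
  set σ : Strategy H k A := fun j s => if i < j then PMF.pure (α j s)
    else if j = i ∧ s = l then PMF.pure a else exploreAction hkH (ord j s) (S j s) with hσ
  have h1 : ∀ j : Fin H, (j : ℕ) < i → σ j = exploreStrategy hkH ord S j := fun j hj => by
    funext s
    have hj' : j < i := hj
    simp [hσ, exploreStrategy, hj'.not_gt, hj'.ne]
  have h2 : M.valueFrom σ (i + 1) = M.valueFrom (pureStrategy α) (i + 1) :=
    M.valueFrom_congr _ i.2 fun j hj => by
      funext s
      have hj' : i < j := hj
      simp [hσ, pureStrategy, hj']
  rw [M.valueFrom_start σ i i.2.le, M.gained_congr i h1, M.reach_congr i h1,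
    ← Finset.sum_erase_add _ _ (Finset.mem_univ l), add_assoc]
  congr 1
  congr 1
  · refine Finset.sum_congr rfl fun s hs => ?_
    have : σ i s = exploreStrategy hkH ord S i s := by
      simp [hσ, exploreStrategy, Finset.ne_of_mem_erase hs]
    rw [valueFrom_succ, h2, this]
  · have : σ i l = PMF.pure a := by simp [hσ]
    rw [valueFrom_succ, h2, this, sum_pure_mul]
    rfl

/-- The unknown common part `B` is finite and cancels, so comparing mean test rewards amounts to
comparing test gains. -/
theorem ofReal_le_add_iff {x y : ℝ} (hy : 0 ≤ y) (c : NNReal) {B X Y : ENNReal}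
    (hX : ENNReal.ofReal x = B + X) (hY : ENNReal.ofReal y = B + Y) :
    x ≤ y + c ↔ X ≤ Y + c := by
  have hB : B ≠ ⊤ := fun h => by simp [h] at hX
  rw [← ENNReal.ofReal_le_ofReal_iff (add_nonneg hy c.coe_nonneg),
    ENNReal.ofReal_add hy c.coe_nonneg, hX, hY, ENNReal.ofReal_coe_nnreal, add_assoc,
    ENNReal.add_le_add_iff_left hB]

theorem testGain_congr {hkH : k ≤ H} {ord : Fin H → Fin k → LinearOrder (Fin A)}
    {S : ActiveSets H k A} {α β : Policy H k A} {i : Fin H} (l : Fin k) (a : Fin A)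
    (h : ∀ j, i < j → α j = β j) :
    M.testGain hkH ord S α i l a = M.testGain hkH ord S β i l a := by
  rw [testGain, testGain, M.valueFrom_congr (σ := pureStrategy α) (τ := pureStrategy β) _ i.2]
  intro j hj
  unfold pureStrategy
  rw [h j hj]

/-- Accuracy in a state depends on `α` only there and in later stages, so it persists while the loop
moves on. -/
theorem IsAccurate.congr {hkH : k ≤ H} {ord : Fin H → Fin k → LinearOrder (Fin A)}
    {S N N' : ActiveSets H k A} {ε : NNReal} {α β : Policy H k A} {i : Fin H} {l : Fin k}
    (h : M.IsAccurate hkH ord S ε α N i l) (h1 : ∀ j, i < j → α j = β j) (h2 : α i l = β i l)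
    (h3 : N i l = N' i l) : M.IsAccurate hkH ord S ε β N' i l where
  mem := by rw [← h2]; exact h.mem
  subset := by rw [← h3]; exact h.subset
  best := by
    simp only [← testGain_congr (M := M) l _ h1, ← h2]; exact h.best
  keep := by
    simp only [← testGain_congr (M := M) l _ h1, ← h2, ← h3]; exact h.keep
  near := by
    simp only [← testGain_congr (M := M) l _ h1, ← h2, ← h3]; exact h.near

/-- Accurate estimates lead to an accurate outcome. -/
theorem isAccurate_update (hM : M.IsNormalized) {hkH : k ≤ H}
    {ord : Fin H → Fin k → LinearOrder (Fin A)} {S : ActiveSets H k A} {ε : NNReal}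
    {α : Policy H k A} {N : ActiveSets H k A} {i : Fin H} {l : Fin k} {Φ : Fin A → ℝ}
    (hΦ : ∀ a ∈ (S i l).1, |Φ a - M.mixValue (testPolicy hkH ord S α i l a)| ≤ ε / 2) :
    M.IsAccurate hkH ord S ε
      (Function.update α i (Function.update (α i) l ((S i l).argmax Φ)))
      (Function.update N i (Function.update (N i) l
        ((S i l).refine Φ (thresholdConst H k A i l * ε)))) i l := by
  obtain ⟨B, hB⟩ := exists_mixValue_testPolicy_eq hM hkH ord S α i l
  have hcongr : ∀ a, M.testGain hkH ord S
      (Function.update α i (Function.update (α i) l ((S i l).argmax Φ))) i l a =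
      M.testGain hkH ord S α i l a := fun a =>
    testGain_congr l a fun j hj => Function.update_of_ne hj.ne' _ _
  have hiff : ∀ a b (c : NNReal), M.mixValue (testPolicy hkH ord S α i l a) ≤
      M.mixValue (testPolicy hkH ord S α i l b) + c ↔
      M.testGain hkH ord S α i l a ≤ M.testGain hkH ord S α i l b + c := fun a b c =>
    ofReal_le_add_iff (mixValue_nonneg hM _) c (hB a) (hB b)
  have hm := (S i l).argmax_mem Φ
  have hC := thresholdConst_eq (A := A) i l
  constructor
  · simpa using hm
  · simp only [Function.update_self]
    exact fun a ha => ((ActionSet.mem_refine _ _ _).1 ha).1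
  · intro a ha
    simp only [hcongr, Function.update_self]
    rw [← hiff]
    have h1 := abs_le.1 (hΦ a ha)
    have h2 := abs_le.1 (hΦ _ hm)
    have h3 := (S i l).le_argmax Φ ha
    linarith [h1.1, h2.2]
  · intro a ha d hd h
    simp only [hcongr, Function.update_self] at h ⊢
    rw [← ENNReal.coe_mul, ← hiff] at h
    rw [ActionSet.mem_refine]
    refine ⟨ha, ?_⟩
    have h1 := abs_le.1 (hΦ a ha)
    have h2 := abs_le.1 (hΦ _ hm)
    -- The two estimation errors raise the gap `d * ε` to at most `(d + 1) * ε`, which is within the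
    -- threshold.
    have h3 : ((d : ℝ) + 1) * ε ≤ levelConst H k A (H - i) l * ε :=
      mul_le_mul_of_nonneg_right (by exact_mod_cast hd) ε.coe_nonneg
    rw [hC]
    rw [NNReal.coe_mul] at h ⊢
    linarith [h1.1, h2.2]
  · intro a ha
    simp only [hcongr, Function.update_self] at ha ⊢
    rw [ActionSet.mem_refine, hC] at ha
    have h1 := abs_le.1 (hΦ a ha.1)
    have h2 := abs_le.1 (hΦ _ hm)
    have h3 := ha.2
    have := (hiff ((S i l).argmax Φ) a ((levelConst H k A (H - i) l + 1) * ε)).1 (by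
      rw [NNReal.coe_mul] at h3
      rw [NNReal.coe_mul, NNReal.coe_add, NNReal.coe_one]
      linarith [h1.2, h2.1])
    rw [ENNReal.coe_mul, ENNReal.coe_add, ENNReal.coe_one] at this
    exact this

variable [NeZero A]

/-- The loop invariant: the states outside `L` have been processed accurately, and their stages are
not before those of `L`. Hence `α` is active in all stages after the current one, and updating the
current state leaves the earlier outcomes accurate. -/
theorem guarantee_learningLoop (hM : M.IsNormalized) {T : ℕ} (hT : 2 ≤ T) {hkH : k ≤ H}
    {ord : Fin H → Fin k → LinearOrder (Fin A)} {S : ActiveSets H k A} {ε : NNReal}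
    (hε : 0 < ε) {n : ℕ} (hn : 12 * Real.log T ≤ n * (ε : ℝ) ^ 2) {δ : ENNReal}
    (hδ : ∀ π : Policy H k A, (∀ j s, π j s ∈ (S j s).1) → M.gap π ≤ δ)
    (L : List (Fin H × Fin k)) (hL : L.Pairwise fun p q => q.1 ≤ p.1)
    (α : Policy H k A) (N : ActiveSets H k A) (h1 : ∀ p ∉ L, ∀ q ∈ L, q.1 ≤ p.1)
    (h2 : ∀ p ∉ L, M.IsAccurate hkH ord S ε α N p.1 p.2) :
    M.Guarantee T (learningLoop hkH ord n ε S L α N) (L.length * (A * (n * δ + 1)))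
      fun N => ∃ α, ∀ i l, M.IsAccurate hkH ord S ε α N i l := by
  induction L generalizing α N with
  | nil => exact Guarantee.ret ⟨α, fun i l => h2 (i, l) (by simp)⟩
  | cons p rest ih =>
    obtain ⟨i, l⟩ := p
    rw [learningLoop]
    rw [List.pairwise_cons] at hL
    have hα : ∀ j, i < j → ∀ s, α j s ∈ (S j s).1 := fun j hj s => by
      refine (h2 (j, s) fun hmem => ?_).mem
      rcases List.mem_cons.1 hmem with h | h
      · exact hj.ne' (congrArg Prod.fst h)
      · exact absurd (hL.1 _ h) (not_le.2 hj)
    have hest := guarantee_estimate hM hT (μ := testPolicy hkH ord S α i l) (δ := δ) hε hn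
      ((S i l).1.sort (· ≤ ·)) fun a ha π hπ =>
        hδ π (mem_of_testPolicy_ne_zero hα ((Finset.mem_sort _).1 ha) hπ)
    refine (hest.bind fun Φ hΦ => ih hL.2 _ _ ?_ ?_).mono ?_ fun _ h => h
    · intro p hp q hq
      by_cases hpi : p = (i, l)
      · rw [hpi]; exact hL.1 q hq
      · exact h1 p (by simp [hpi, hp]) q (by simp [hq])
    · intro p hp
      by_cases hpi : p = (i, l)
      · rw [hpi]
        exact isAccurate_update hM fun a ha => hΦ a ((Finset.mem_sort _).2 ha)
      · have hp' : p ∉ (i, l) :: rest := by simp [hpi, hp]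
        have hip : i ≤ p.1 := h1 p hp' (i, l) (by simp)
        have hupd : ∀ {β : Type} (f : Fin H → Fin k → β) (b : β),
            Function.update f i (Function.update (f i) l b) p.1 p.2 = f p.1 p.2 := by
          intro β f b
          rcases eq_or_ne p.1 i with h | h
          · rw [h, Function.update_self, Function.update_of_ne]
            exact fun h' => hpi (Prod.ext h h')
          · rw [Function.update_of_ne h]
        refine (h2 p hp').congr (fun j hj => ?_) (hupd α _).symm (hupd N _).symm
        rw [Function.update_of_ne (hip.trans_lt hj).ne']
    · rw [List.length_cons, Finset.length_sort]
      have : (((S i l).1.card : ℕ) : ENNReal) ≤ A := by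
        exact_mod_cast (Finset.card_le_univ (S i l).1).trans_eq (Fintype.card_fin A)
      push_cast
      calc _ ≤ (A : ENNReal) * (n * δ + 1) + rest.length * (A * (n * δ + 1)) := by gcongr
        _ = _ := by ring

/-! ### The order in which a phase visits the states, and its total regret. -/

theorem length_statesBackward (H k : ℕ) : (statesBackward H k).length = H * k := by
  rw [statesBackward, List.length_product]
  simp

theorem mem_statesBackward (p : Fin H × Fin k) : p ∈ statesBackward H k := by
  rw [statesBackward, List.mem_product]
  simp

theorem pairwise_statesBackward (H k : ℕ) :
    (statesBackward H k).Pairwise fun p q => q.1 ≤ p.1 := by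
  change (List.flatMap _ _).Pairwise _
  rw [List.pairwise_flatMap]
  refine ⟨fun i _ => List.pairwise_map.2 (List.pairwise_of_forall fun _ _ => le_rfl), ?_⟩
  rw [List.pairwise_reverse]
  refine (List.pairwise_le_finRange H).imp fun {i j} hij p hp q hq => ?_
  obtain ⟨_, _, rfl⟩ := List.mem_map.1 hp
  obtain ⟨_, _, rfl⟩ := List.mem_map.1 hq
  exact hij

/-- The action sets contain the optimal actions and lead to a loss of at most `d`. -/
def IsActive (M : EpisodicMDP H k A) (π : Policy H k A) (d : NNReal) (S : ActiveSets H k A) :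
    Prop :=
  (∀ i l, π i l ∈ (S i l).1) ∧
    ∀ ρ : Policy H k A, (∀ i l, ρ i l ∈ (S i l).1) → M.gap ρ ≤ d

theorem guarantee_orderedExpRef (hM : M.IsNormalized) {T : ℕ} (hT : 2 ≤ T) (hk : 1 ≤ k)
    {hkH : k ≤ H} {ord : Fin H → Fin k → LinearOrder (Fin A)} (hord : M.IsOrdered ord)
    {S : ActiveSets H k A} {ε : NNReal} (hε : 0 < ε) {π : Policy H k A}
    (hπ : ∀ (σ : Policy H k A) (i : ℕ), i ≤ H → ∀ s,
      M.valueFrom (pureStrategy σ) i s ≤ M.valueFrom (pureStrategy π) i s)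
    {δ : NNReal} (hS : M.IsActive π δ S) :
    M.Guarantee T (orderedExpRef hkH ord T ε S)
      ((H * k : ℕ) * (A * (⌈12 * Real.log T / (ε : ℝ) ^ 2⌉₊ * δ + 1)))
      (M.IsActive π (phaseLoss H k A * ε)) := by
  have hn : 12 * Real.log T ≤ ⌈12 * Real.log T / (ε : ℝ) ^ 2⌉₊ * (ε : ℝ) ^ 2 := by
    have hε' : (0 : ℝ) < ε := by exact_mod_cast hε
    rw [← div_le_iff₀ (by positivity)]
    exact Nat.le_ceil _
  -- All states are still to be processed, so the invariant holds vacuously for the dummy initial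
  -- policy.
  have h := guarantee_learningLoop hM hT (hkH := hkH) (ord := ord) hε hn hS.2
    (statesBackward H k) (pairwise_statesBackward H k) (fun _ _ => 0) S
    (fun p hp => absurd (mem_statesBackward p) hp) (fun p hp => absurd (mem_statesBackward p) hp)
  rw [length_statesBackward] at h
  refine h.mono le_rfl ?_
  rintro N ⟨α, hα⟩
  refine ⟨?_, fun ρ hρ => ?_⟩
  · exact fun i l => (optimal_of_isAccurate hk hord hα (hπ α) hS.1 0 (Nat.zero_le _)).2 i
      (Nat.zero_le _) l
  · refine gap_le_of_totalValue_le hM (fun σ => hπ σ 0 (Nat.zero_le _) _) ?_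
    rw [ENNReal.coe_mul]
    exact totalValue_le_of_isAccurate hk hord hα (hπ α) hS.1 hρ

/-! ### All phases -/

/-- The loss of active policies at the beginning of phase `r`. -/
def activeLoss (H k A r : ℕ) : NNReal := 2 * phaseLoss H k A * (1 / 2) ^ r

/-- A bound for the regret of phase `r`. -/
def phaseRegret (H k A T r : ℕ) : ENNReal :=
  (H * k : ℕ) * (A * (⌈12 * Real.log T / (((1 / 2) ^ r : NNReal) : ℝ) ^ 2⌉₊ *
    activeLoss H k A r + 1))

theorem guarantee_runPhases (hM : M.IsNormalized) {T : ℕ} (hT : 2 ≤ T) (hk : 1 ≤ k)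
    {hkH : k ≤ H} {ord : Fin H → Fin k → LinearOrder (Fin A)} (hord : M.IsOrdered ord)
    {π : Policy H k A} (hπ : ∀ (σ : Policy H k A) (i : ℕ), i ≤ H → ∀ s,
      M.valueFrom (pureStrategy σ) i s ≤ M.valueFrom (pureStrategy π) i s)
    (m r : ℕ) {S : ActiveSets H k A} (hS : M.IsActive π (activeLoss H k A r) S) :
    M.Guarantee T (runPhases hkH ord T m r S) (∑ j ∈ Finset.range m, phaseRegret H k A T (r + j))
      (M.IsActive π (activeLoss H k A (r + m))) := by
  induction m generalizing r S with
  | zero => exact Guarantee.ret hS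
  | succ m ih =>
    rw [runPhases]
    -- The loss guaranteed by phase `r` is the one assumed by phase `r + 1`: halving `ε` explains
    -- the factor 2 in `activeLoss`.
    have hloss : phaseLoss H k A * (1 / 2) ^ r = activeLoss H k A (r + 1) := by
      rw [activeLoss, pow_succ]
      rw [mul_comm 2, mul_assoc (phaseLoss H k A)]
      congr 1
      rw [mul_left_comm, mul_one_div, div_self two_ne_zero, mul_one]
    have h := guarantee_orderedExpRef hM hT hk (hkH := hkH) hord
      (ε := (1 / 2) ^ r) (by positivity) hπ hS
    rw [hloss] at h
    refine (h.bind fun N hN => ih (r + 1) hN).mono (le_of_eq ?_) fun N hN => ?_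
    · rw [Finset.sum_range_succ', add_comm]
      congr 1
      exact Finset.sum_congr rfl fun j _ => by rw [add_right_comm, add_assoc]
    · rwa [add_right_comm, add_assoc] at hN

theorem one_le_phaseLoss (hk : 1 ≤ k) (hkH : k ≤ H) : 1 ≤ phaseLoss H k A := by
  have hH : (1 : NNReal) ≤ H := by exact_mod_cast hk.trans hkH
  rw [phaseLoss]
  refine one_le_mul (one_le_mul (by norm_num) hH)
    (one_le_levelConst hk hkH (NeZero.one_le) (hk.trans hkH) _)

theorem expectedRegret_orderedAlgorithm_le (hM : M.IsNormalized) {T : ℕ} (hT : 2 ≤ T)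
    (hk : 1 ≤ k) (hkH : k ≤ H) {ord : Fin H → Fin k → LinearOrder (Fin A)}
    (hord : M.IsOrdered ord) :
    M.expectedRegret T (orderedAlgorithm hkH ord T) ≤
      ∑ r ∈ Finset.range (numPhases H k A T), phaseRegret H k A T r +
        T * activeLoss H k A (numPhases H k A T) := by
  obtain ⟨π, hπ⟩ := M.exists_optimal_policy
  have hS : M.IsActive π (activeLoss H k A 0) (fun _ _ => ActionSet.full A) := by
    -- Before the first phase the trivial bound 1 on the gap suffices, because `phaseLoss` is at
    -- least 1.
    refine ⟨fun i l => Finset.mem_univ _, fun ρ _ => (gap_le_one hM ρ).trans ?_⟩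
    rw [activeLoss, pow_zero, mul_one]
    exact_mod_cast one_le_mul (by norm_num) (one_le_phaseLoss hk hkH)
  have h := guarantee_runPhases hM hT hk (hkH := hkH) hord hπ (numPhases H k A T) 0 hS
  simp only [zero_add] at h
  refine h _ _ (fun S hS m hm => ?_) T le_rfl
  rw [cost_ret]
  exact mul_le_mul' (by exact_mod_cast hm) (hS.2 _ fun i l => Finset.min'_mem _ _)

end EpisodicMDP

/-! ### The regret bound -/

namespace EpisodicMDP
variable {H k A : ℕ}

theorem half_le_log {T : ℕ} (hT : 2 ≤ T) : 1 / 2 ≤ Real.log T := by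
  have h := Real.log_two_gt_d9
  have : Real.log 2 ≤ Real.log T :=
    Real.log_le_log (by norm_num) (by exact_mod_cast hT)
  linarith

/-- As `2 * log T ≥ 1`, rounding up turns 12 into 14. The factor 2 of `activeLoss` gives 28, and the
failure cost 1 is absorbed by another 2. -/
theorem phaseRegret_le [NeZero A] (hk : 1 ≤ k) (hkH : k ≤ H) {T : ℕ} (hT : 2 ≤ T) (r : ℕ) :
    phaseRegret H k A T r ≤
      ENNReal.ofReal (30 * (H * k * A * Real.log T * phaseLoss H k A) * 2 ^ r) := by
  have hB : (1 : ℝ) ≤ phaseLoss H k A := by exact_mod_cast one_le_phaseLoss hk hkH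
  have hL := half_le_log hT
  set L := Real.log T
  set n := ⌈12 * L / (((1 / 2) ^ r : NNReal) : ℝ) ^ 2⌉₊ with hn
  set B : ℝ := ((phaseLoss H k A : NNReal) : ℝ) with hBdef
  have hL0 : (0 : ℝ) < L := by linarith
  have hpow : (1 : ℝ) ≤ 2 ^ r := one_le_pow₀ (by norm_num)
  have hn' : (n : ℝ) ≤ 14 * L * (2 ^ r) ^ 2 := by
    have h1 : (((1 / 2) ^ r : NNReal) : ℝ) ^ 2 = 1 / (2 ^ r) ^ 2 := by
      push_cast
      rw [div_pow, one_pow, div_pow, one_pow]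
    have h2 : (n : ℝ) ≤ 12 * L * (2 ^ r) ^ 2 + 1 := by
      have h3 := (Nat.ceil_lt_add_one (a := 12 * L / (((1 / 2) ^ r : NNReal) : ℝ) ^ 2)
        (by positivity)).le
      rw [← hn, h1, div_div_eq_mul_div, div_one] at h3
      exact h3
    have h4 : (1 : ℝ) ≤ (2 ^ r) ^ 2 := one_le_pow₀ hpow
    have : 1 ≤ 2 * L * (2 ^ r) ^ 2 := one_le_mul_of_one_le_of_one_le (by linarith) h4
    linarith
  have hreal : phaseRegret H k A T r =
      ENNReal.ofReal ((H * k) * (A * (n * (2 * B * (1 / 2) ^ r) + 1))) := by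
    have : ((H * k) * (A * (n * (2 * B * (1 / 2) ^ r) + 1)) : ℝ) =
        (((H * k : ℕ) * (A * (n * activeLoss H k A r + 1)) : NNReal) : ℝ) := by
      rw [activeLoss]
      push_cast
      rfl
    rw [this, ENNReal.ofReal_coe_nnreal, phaseRegret]
    push_cast
    rfl
  rw [hreal]
  refine ENNReal.ofReal_le_ofReal ?_
  have h5 : (n : ℝ) * (2 * B * (1 / 2) ^ r) ≤ 28 * (L * B) * 2 ^ r := by
    calc (n : ℝ) * (2 * B * (1 / 2) ^ r) ≤ 14 * L * (2 ^ r) ^ 2 * (2 * B * (1 / 2) ^ r) := by gcongr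
      _ = 28 * (L * B) * 2 ^ r * (2 ^ r * (1 / 2) ^ r) := by ring
      _ = _ := by rw [← mul_pow]; norm_num
  have h6 : 1 ≤ 2 * (L * B) * 2 ^ r := by
    refine one_le_mul_of_one_le_of_one_le ?_ hpow
    rw [← mul_assoc]
    exact one_le_mul_of_one_le_of_one_le (by linarith) hB
  calc (H * k : ℝ) * (A * (n * (2 * B * (1 / 2) ^ r) + 1)) ≤
        (H * k : ℝ) * (A * (28 * (L * B) * 2 ^ r + 2 * (L * B) * 2 ^ r)) := by gcongr
    _ = _ := by ring

theorem half_pow_numPhases_le {T : ℕ} (hT : 2 ≤ T) (hk : 1 ≤ k) (hkH : k ≤ H) (hA : 1 ≤ A) :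
    (1 / 2 : ℝ) ^ numPhases H k A T ≤ √(H * k * A * Real.log T / T) := by
  have hL := half_le_log hT
  have hk' : (0 : ℝ) < k := by exact_mod_cast hk
  have hH' : (0 : ℝ) < H := by exact_mod_cast hk.trans hkH
  have hA' : (0 : ℝ) < A := by exact_mod_cast hA
  have hT' : (0 : ℝ) < T := by exact_mod_cast (by omega : 0 < T)
  have hpos : 0 < √(H * k * A * Real.log T / T) := by positivity
  obtain ⟨r, hr⟩ := exists_pow_lt_of_lt_one hpos (by norm_num : (1 / 2 : ℝ) < 1)
  exact Nat.sInf_mem (s := {r : ℕ | (1 / 2 : ℝ) ^ r ≤ √(H * k * A * Real.log T / T)}) ⟨r, hr.le⟩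

/-- If the last phase is `R`, the loop was still running there, so the target accuracy is below `2 ^
(-R)`, while the sum is below `2 ^ (R + 1)`. -/
theorem sum_two_pow_numPhases_mul_le {T : ℕ} :
    (∑ r ∈ Finset.range (numPhases H k A T), (2 : ℝ) ^ r) * √(H * k * A * Real.log T / T) ≤ 2 := by
  rcases hR : numPhases H k A T with _ | R
  · simp
  · have h : R ∉ {r : ℕ | (1 / 2 : ℝ) ^ r ≤ √(H * k * A * Real.log T / T)} :=
      Nat.notMem_of_lt_sInf (by rw [← numPhases, hR]; exact Nat.lt_succ_self R)
    have h' : √(H * k * A * Real.log T / T) ≤ (1 / 2 : ℝ) ^ R := (lt_of_not_ge h).le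
    calc _ ≤ (2 : ℝ) ^ (R + 1) * (1 / 2) ^ R := by
          gcongr
          rw [geom_sum_eq (by norm_num)]
          norm_num
      _ = 2 * (2 ^ R * (1 / 2) ^ R) := by ring
      _ = 2 := by rw [← mul_pow]; norm_num

/-- `stayFactor ^ (H - 1) ≤ e ^ k`, and `3 * H = 3/2 * (k/A) * (2AH/k)` supplies the missing factor
for a full `k`-th power. -/
theorem phaseLoss_le [NeZero A] (hk : 1 ≤ k) (hkH : k ≤ H) :
    (phaseLoss H k A : ℝ) ≤
      3 / 2 * (k / A) * (2 * Real.exp 1 * (H : ℝ) ^ 2 * A / k) ^ k := by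
  have hk' : (0 : ℝ) < k := by exact_mod_cast hk
  have hH' : (0 : ℝ) < H := by exact_mod_cast hk.trans hkH
  have hA' : (0 : ℝ) < A := by exact_mod_cast Nat.pos_of_ne_zero (NeZero.ne A)
  have hy : ((stayFactor H k : NNReal) : ℝ) ^ (H - 1) ≤ Real.exp 1 ^ k := by
    rw [stayFactor, Real.coe_toNNReal _ (Real.exp_nonneg _), ← Real.exp_nat_mul,
      ← Real.exp_nat_mul, mul_one]
    refine Real.exp_le_exp.2 ?_
    rw [mul_div_assoc', div_le_iff₀ hH', mul_comm]
    gcongr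
    omega
  have hx : ((uniformFactor H k A : NNReal) : ℝ) = 2 * A * H / k := by
    rw [uniformFactor]; push_cast; rfl
  rw [phaseLoss, levelConst]
  push_cast
  rw [hx]
  obtain ⟨j, rfl⟩ : ∃ j, k = j + 1 := ⟨k - 1, by omega⟩
  rw [Nat.add_sub_cancel]
  calc (3 * H * (((stayFactor H (j + 1) : NNReal) : ℝ) ^ (H - 1) *
        (2 * A * H / (j + 1 : ℕ)) ^ j * (H : ℝ) ^ (j + 1)) : ℝ) ≤
        3 * H * (Real.exp 1 ^ (j + 1) * (2 * A * H / (j + 1 : ℕ)) ^ j * (H : ℝ) ^ (j + 1)) := by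
        gcongr
    _ = 3 / 2 * ((j + 1 : ℕ) / A) * ((2 * A * H / (j + 1 : ℕ)) * (Real.exp 1 ^ (j + 1) *
        (2 * A * H / (j + 1 : ℕ)) ^ j * (H : ℝ) ^ (j + 1))) := by
        field_simp
    _ = 3 / 2 * ((j + 1 : ℕ) / A) * (Real.exp 1 * (2 * A * H / (j + 1 : ℕ)) * H) ^ (j + 1) := by
        rw [mul_pow, mul_pow]; ring
    _ = _ := by
        congr 2
        ring

variable {M : EpisodicMDP H k A}

/-- With `Q = √(HkA T log T)`, the phases cost `30 * 2` and the remaining episodes 2, in units of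
`phaseLoss * Q`; then `62 * 3/2 = 93`, and `k/A` moves under the root. -/
theorem expectedRegret_orderedAlgorithm_le_ofReal [NeZero A] (hM : M.IsNormalized) {T : ℕ}
    (hT : 2 ≤ T) (hk : 1 ≤ k) (hkH : k ≤ H) {ord : Fin H → Fin k → LinearOrder (Fin A)}
    (hord : M.IsOrdered ord) :
    M.expectedRegret T (orderedAlgorithm hkH ord T) ≤
      ENNReal.ofReal (93 * ((2 * Real.exp 1 * (H : ℝ) ^ 2 * A / k) ^ k *
        √((k : ℝ) ^ 3 * H / A * T * Real.log T))) := by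
  have hk' : (0 : ℝ) < k := by exact_mod_cast hk
  have hH' : (0 : ℝ) < H := by exact_mod_cast hk.trans hkH
  have hA' : (0 : ℝ) < A := by exact_mod_cast Nat.pos_of_ne_zero (NeZero.ne A)
  have hT' : (0 : ℝ) < T := by exact_mod_cast (by omega : 0 < T)
  have hL : 0 < Real.log T := by linarith [half_le_log hT]
  set R := numPhases H k A T
  set L := Real.log T
  set B : ℝ := ((phaseLoss H k A : NNReal) : ℝ) with hB
  set η := √(H * k * A * L / T) with hη
  have hη0 : 0 < η := by positivity
  have hPη : H * k * A * L = √(H * k * A * L * T) * η := by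
    rw [hη, ← Real.sqrt_mul (by positivity), mul_div_assoc', mul_right_comm _ (T : ℝ),
      mul_div_cancel_right₀ _ hT'.ne', Real.sqrt_mul_self (by positivity)]
  have hTη : T * η = √(H * k * A * L * T) := by
    rw [hη, ← Real.sqrt_sq hT'.le, ← Real.sqrt_mul (by positivity), Real.sqrt_sq hT'.le]
    congr 1
    field_simp
  set Q := √(H * k * A * L * T) with hQ
  have h1 : ∑ r ∈ Finset.range R, phaseRegret H k A T r ≤ ENNReal.ofReal (60 * (B * Q)) := by
    refine (Finset.sum_le_sum fun r _ => phaseRegret_le hk hkH hT r).trans ?_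
    rw [← ENNReal.ofReal_sum_of_nonneg fun r _ => by positivity, ← Finset.mul_sum]
    refine ENNReal.ofReal_le_ofReal ?_
    change 30 * (H * k * A * L * B) * _ ≤ _
    rw [hPη]
    have := sum_two_pow_numPhases_mul_le (H := H) (k := k) (A := A) (T := T)
    calc 30 * (Q * η * B) * ∑ r ∈ Finset.range R, (2 : ℝ) ^ r =
          30 * (B * Q) * ((∑ r ∈ Finset.range R, (2 : ℝ) ^ r) * η) := by ring
      _ ≤ 30 * (B * Q) * 2 := by gcongr
      _ = _ := by ring
  have h2 : (T : ENNReal) * activeLoss H k A R ≤ ENNReal.ofReal (2 * (B * Q)) := by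
    have : (T : ENNReal) * activeLoss H k A R = ENNReal.ofReal (T * (2 * B * (1 / 2) ^ R)) := by
      have : (T * (2 * B * (1 / 2) ^ R) : ℝ) = ((T * activeLoss H k A R : NNReal) : ℝ) := by
        rw [activeLoss]; push_cast; rfl
      rw [this, ENNReal.ofReal_coe_nnreal]
      push_cast
      rfl
    rw [this]
    refine ENNReal.ofReal_le_ofReal ?_
    have := half_pow_numPhases_le (H := H) (k := k) (A := A) hT hk hkH NeZero.one_le
    calc (T * (2 * B * (1 / 2) ^ R) : ℝ) ≤ T * (2 * B * η) := by gcongr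
      _ = 2 * (B * (T * η)) := by ring
      _ = _ := by rw [hTη]
  refine (expectedRegret_orderedAlgorithm_le hM hT hk hkH hord).trans ((add_le_add h1 h2).trans ?_)
  rw [← ENNReal.ofReal_add (by positivity) (by positivity)]
  refine ENNReal.ofReal_le_ofReal ?_
  have hQ' : k / A * Q = √((k : ℝ) ^ 3 * H / A * T * L) := by
    rw [hQ, ← Real.sqrt_sq (by positivity : (0 : ℝ) ≤ k / A), ← Real.sqrt_mul (by positivity)]
    congr 1
    field_simp
  calc 60 * (B * Q) + 2 * (B * Q) = 62 * (B * Q) := by ring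
    _ ≤ 62 * (3 / 2 * (k / A) * (2 * Real.exp 1 * (H : ℝ) ^ 2 * A / k) ^ k * Q) := by
        gcongr
        exact phaseLoss_le hk hkH
    _ = 93 * ((2 * Real.exp 1 * (H : ℝ) ^ 2 * A / k) ^ k * (k / A * Q)) := by ring
    _ = _ := by rw [hQ']

end EpisodicMDP

/-! ### Measurability of the algorithm -/

namespace BanditProg

variable {P : Type} [MeasurableSpace P] {X α β : Type} [MeasurableSpace X] [MeasurableSpace α]
  [MeasurableSpace β]

/-- The actions of a family of programs depend measurably on the parameter and the history. -/
def ActMeasurable (F : X → BanditProg P P) : Prop :=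
  ∀ (t : ℕ) (π : P), Measurable fun p : X × (Fin t → P × ℝ) => (F p.1).act (List.ofFn p.2) π

/-- A family of programs that preserves the measurable dependence of subsequent programs on
parameters. -/
def MeasurableFamily (F : X → BanditProg P α) : Prop :=
  ∀ (Y : Type) [MeasurableSpace Y] (φ : Y → X), Measurable φ → ∀ G : Y → α → BanditProg P P,
    ActMeasurable (fun p : Y × α => G p.1 p.2) → ActMeasurable fun y => (F (φ y)).bind (G y)

theorem ActMeasurable.comp {Y : Type} [MeasurableSpace Y] {F : X → BanditProg P P}
    (hF : ActMeasurable F) {ψ : Y → X} (hψ : Measurable ψ) : ActMeasurable fun y => F (ψ y) :=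
  fun t π => (hF t π).comp ((hψ.comp measurable_fst).prodMk measurable_snd)

theorem ActMeasurable.ret [Countable P] [MeasurableSingletonClass P] {a : X → P}
    (ha : Measurable a) : ActMeasurable fun x => (.ret (a x) : BanditProg P P) := by
  intro t π
  simp only [act]
  exact (measurable_of_countable fun b => PMF.pure b π).comp (ha.comp measurable_fst)

theorem MeasurableFamily.comp {Y : Type} [MeasurableSpace Y] {F : X → BanditProg P α}
    (hF : MeasurableFamily F) {ψ : Y → X} (hψ : Measurable ψ) :
    MeasurableFamily fun y => F (ψ y) :=
  fun Z _ φ hφ G hG => hF Z (fun z => ψ (φ z)) (hψ.comp hφ) G hG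

theorem MeasurableFamily.ret {a : X → α} (ha : Measurable a) :
    MeasurableFamily fun x => (.ret (a x) : BanditProg P α) :=
  fun _ _ _ hφ _ hG => hG.comp (measurable_id.prodMk (ha.comp hφ))

/-- Quantifying over all parameter spaces `Y` in `MeasurableFamily` pays off here: the intermediate
result becomes one more parameter. -/
theorem MeasurableFamily.bind {F : X → BanditProg P α} {G : X → α → BanditProg P β}
    (hF : MeasurableFamily F) (hG : MeasurableFamily fun p : X × α => G p.1 p.2) :
    MeasurableFamily fun x => (F x).bind (G x) := by
  intro Y _ φ hφ K hK
  simp only [EpisodicMDP.prog_bind_assoc]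
  refine hF Y φ hφ (fun y a => (G (φ y) a).bind (K y)) ?_
  exact hG (Y × α) (fun p => (φ p.1, p.2)) ((hφ.comp measurable_fst).prodMk measurable_snd)
    (fun p => K p.1) (hK.comp ((measurable_fst.comp measurable_fst).prodMk measurable_snd))

theorem MeasurableFamily.play (μ : PMF P) {next : X → ℝ → BanditProg P α}
    (h : MeasurableFamily fun p : X × ℝ => next p.1 p.2) :
    MeasurableFamily fun x => BanditProg.play μ (next x) := by
  intro Y _ φ hφ G hG t π
  cases t with
  | zero =>
    simp only [BanditProg.bind, List.ofFn_zero, act]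
    exact measurable_const
  | succ t =>
    simp only [BanditProg.bind, List.ofFn_succ, act]
    -- The first reward of the history becomes a parameter of the rest of the program.
    have := h (Y × ℝ) (fun p => (φ p.1, p.2)) ((hφ.comp measurable_fst).prodMk measurable_snd)
      (fun p => G p.1) (hG.comp ((measurable_fst.comp measurable_fst).prodMk measurable_snd)) t π
    exact this.comp (g := fun p : (Y × ℝ) × (Fin t → P × ℝ) =>
      ((next (φ p.1.1) p.1.2).bind (G p.1.1)).act (List.ofFn p.2) π)
      (f := fun p : Y × (Fin (t + 1) → P × ℝ) => ((p.1, (p.2 0).2), fun i => p.2 i.succ))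
      (by fun_prop)

/-- For programs that use real feedback only through a discrete decision: measurable level sets of
the decision suffice. -/
theorem MeasurableFamily.of_countable {D : Type} [Countable D] {F : D → BanditProg P α}
    (hF : ∀ d, MeasurableFamily fun _ : X => F d) {ψ : X → D}
    (hψ : ∀ d, MeasurableSet {x | ψ x = d}) : MeasurableFamily fun x => F (ψ x) := by
  intro Y _ φ hφ G hG t π
  let _ : MeasurableSpace D := ⊤
  have hψ' : Measurable ψ := measurable_to_countable' fun d => hψ d
  have h : Measurable fun q : D × (Y × (Fin t → P × ℝ)) =>
      ((F q.1).bind (G q.2.1)).act (List.ofFn q.2.2) π :=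
    measurable_from_prod_countable_right fun d => hF d Y φ hφ G hG t π
  exact h.comp (((hψ'.comp hφ).comp measurable_fst).prodMk measurable_id)

theorem measurableFamily_sumRewards (μ : PMF P) (n : ℕ) :
    MeasurableFamily fun acc : ℝ => sumRewards μ n acc := by
  induction n with
  | zero => exact MeasurableFamily.ret measurable_id
  | succ n ih =>
    exact MeasurableFamily.play μ (next := fun acc x => sumRewards μ n (acc + x))
      (ih.comp (measurable_fst.add measurable_snd))

theorem measurableFamily_sampleMean (μ : PMF P) (n : ℕ) :
    MeasurableFamily fun _ : X => sampleMean μ n :=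
  MeasurableFamily.bind (F := fun _ : X => sumRewards μ n 0)
    ((measurableFamily_sumRewards μ n).comp measurable_const)
    (G := fun _ s => BanditProg.ret (s / n)) (.ret (measurable_snd.div_const _))

theorem measurableFamily_estimate {A : ℕ} (μ : Fin A → PMF P) (n : ℕ) (as : List (Fin A)) :
    MeasurableFamily fun _ : X => estimate μ n as := by
  induction as generalizing X with
  | nil => exact MeasurableFamily.ret measurable_const
  | cons a as ih =>
    refine (measurableFamily_sampleMean (μ a) n).bind (G := fun _ m => (estimate μ n as).bind
      fun f => BanditProg.ret (Function.update f a m))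
      (MeasurableFamily.bind (F := fun _ : X × ℝ => estimate μ n as) ih
      (G := fun (p : X × ℝ) f => BanditProg.ret (Function.update f a p.2)) (.ret ?_))
    refine measurable_pi_iff.2 fun b => ?_
    rcases eq_or_ne b a with rfl | h
    · simp only [Function.update_self]; fun_prop
    · simp only [Function.update_of_ne h]; fun_prop

end BanditProg

open BanditProg

/-! ### Measurability of the decisions taken in a phase. -/

theorem ActionSet.argmax_eq_iff {A : ℕ} (S : ActionSet A) (f : Fin A → ℝ) (a : Fin A) :
    S.argmax f = a ↔ (a ∈ S.1 ∧ ∀ b ∈ S.1, f b ≤ f a) ∧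
      ∀ a', (a' ∈ S.1 ∧ ∀ b ∈ S.1, f b ≤ f a') → a ≤ a' := by
  rw [ActionSet.argmax, Finset.min'_eq_iff]
  simp only [Finset.mem_filter]

theorem ActionSet.measurableSet_argmax_eq {A : ℕ} (S : ActionSet A) (a : Fin A) :
    MeasurableSet {f : Fin A → ℝ | S.argmax f = a} := by
  have hmax : ∀ a, MeasurableSet {f : Fin A → ℝ | a ∈ S.1 ∧ ∀ b ∈ S.1, f b ≤ f a} := fun a => by
    simp only [Set.ofPred_and, Set.ofPred_forall]
    exact .inter (.const _) (.iInter fun b => .iInter fun _ =>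
      measurableSet_le (measurable_pi_apply b) (measurable_pi_apply a))
  have : {f : Fin A → ℝ | S.argmax f = a} = {f | a ∈ S.1 ∧ ∀ b ∈ S.1, f b ≤ f a} ∩
      ⋂ a', {f | a' ∈ S.1 ∧ ∀ b ∈ S.1, f b ≤ f a'}ᶜ ∪ {_f | a ≤ a'} := by
    ext f
    simp only [Set.mem_ofPred_eq, argmax_eq_iff, Set.mem_inter_iff, Set.mem_iInter, Set.mem_union,
      Set.mem_compl_iff, imp_iff_not_or]
  rw [this]
  exact (hmax a).inter (.iInter fun a' => (hmax a').compl.union (.const _))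

theorem ActionSet.measurable_apply_argmax {A : ℕ} (S : ActionSet A) :
    Measurable fun f : Fin A → ℝ => f (S.argmax f) := by
  have h : Measurable fun q : Fin A × (Fin A → ℝ) => q.2 q.1 :=
    measurable_from_prod_countable_right fun a => measurable_pi_apply a
  exact h.comp ((measurable_to_countable' fun a => S.measurableSet_argmax_eq a).prodMk
    measurable_id)

theorem ActionSet.measurableSet_refine_eq {A : ℕ} (S : ActionSet A) (δ : NNReal)
    (N : ActionSet A) : MeasurableSet {f : Fin A → ℝ | S.refine f δ = N} := by
  have : {f : Fin A → ℝ | S.refine f δ = N} =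
      ⋂ a, {f | (a ∈ S.1 ∧ f (S.argmax f) - (δ : ℝ) ≤ f a) ↔ a ∈ N.1} := by
    ext f
    simp only [Set.mem_ofPred_eq, Set.mem_iInter, Subtype.ext_iff, Finset.ext_iff, mem_refine]
  rw [this]
  exact .iInter fun a => .iff (.inter (.const _) (measurableSet_le
    (S.measurable_apply_argmax.sub_const _) (measurable_pi_apply a))) (.const _)

instance (A : ℕ) : MeasurableSpace (ActionSet A) := ⊤

instance (A : ℕ) : DiscreteMeasurableSpace (ActionSet A) := ⟨fun _ => trivial⟩

variable {H k A : ℕ}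

theorem measurableFamily_learningLoop {X : Type} [MeasurableSpace X] (hkH : k ≤ H)
    (ord : Fin H → Fin k → LinearOrder (Fin A)) (n : ℕ) (ε : NNReal) (S : ActiveSets H k A)
    (L : List (Fin H × Fin k)) (α : Policy H k A) (N : ActiveSets H k A) :
    MeasurableFamily fun _ : X => learningLoop hkH ord n ε S L α N := by
  induction L generalizing X α N with
  | nil => exact MeasurableFamily.ret measurable_const
  | cons p rest ih =>
    obtain ⟨i, l⟩ := p
    simp only [learningLoop]
    refine MeasurableFamily.bind (F := fun _ : X => estimate (testPolicy hkH ord S α i l) n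
      ((S i l).1.sort (· ≤ ·))) (measurableFamily_estimate _ _ _) (G := fun _ Φ => learningLoop hkH ord n ε S rest
        (Function.update α i (Function.update (α i) l ((S i l).argmax Φ)))
        (Function.update N i (Function.update (N i) l
          ((S i l).refine Φ (thresholdConst H k A i l * ε))))) ?_
    -- The estimates influence the rest of the loop only through the chosen action and the refined
    -- set.
    refine MeasurableFamily.of_countable (X := X × (Fin A → ℝ)) (D := Fin A × ActionSet A)
      (F := fun d => learningLoop hkH ord n ε S rest
        (Function.update α i (Function.update (α i) l d.1))
        (Function.update N i (Function.update (N i) l d.2))) (fun d => ih _ _)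
      (ψ := fun p => ((S i l).argmax p.2, (S i l).refine p.2 (thresholdConst H k A i l * ε)))
      fun d => ?_
    simp only [Prod.ext_iff]
    exact (measurable_snd ((S i l).measurableSet_argmax_eq d.1)).inter
      (measurable_snd ((S i l).measurableSet_refine_eq _ d.2))

theorem measurableFamily_runPhases [NeZero A] {X : Type} [MeasurableSpace X] (hkH : k ≤ H)
    (ord : Fin H → Fin k → LinearOrder (Fin A)) (T m r : ℕ) (S : ActiveSets H k A) :
    MeasurableFamily fun _ : X => runPhases hkH ord T m r S := by
  induction m generalizing X r S with
  | zero => exact MeasurableFamily.ret measurable_const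
  | succ m ih =>
    refine MeasurableFamily.bind (F := fun _ : X => orderedExpRef hkH ord T ((1 / 2) ^ r) S)
      (measurableFamily_learningLoop hkH ord _ _ S _ _ _)
      (G := fun _ N => runPhases hkH ord T m (r + 1) N) ?_
    exact MeasurableFamily.of_countable (F := fun N => runPhases hkH ord T m (r + 1) N)
      (fun N => ih _ _) fun N => measurable_snd (measurableSet_singleton N)

theorem isMeasurable_orderedAlgorithm [NeZero A] (hkH : k ≤ H)
    (ord : Fin H → Fin k → LinearOrder (Fin A)) (T : ℕ) :
    (orderedAlgorithm hkH ord T).IsMeasurable := by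
  intro t π
  have h := measurableFamily_runPhases (X := Unit) hkH ord T (numPhases H k A T) 0
    (fun _ _ => ActionSet.full A) Unit id measurable_id
    (fun _ S => .ret fun i l => (S i l).1.min' (S i l).2)
    (.ret ((measurable_of_countable fun S : ActiveSets H k A =>
      ((fun i l => (S i l).1.min' (S i l).2 : Policy H k A))).comp measurable_snd)) t π
  exact h.comp (measurable_const.prodMk measurable_id : Measurable fun h => ((), h))

/-! ### Problems with independent data -/

/-- Resampling one coordinate of a product measure. -/
theorem lintegral_pi_resample {ι : Type*} [Fintype ι] [DecidableEq ι] {Ω : Type*}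
    [MeasurableSpace Ω] (μ : ι → Measure Ω) [∀ i, IsProbabilityMeasure (μ i)]
    {F : (ι → Ω) → ENNReal} (hF : Measurable F) (i : ι) :
    ∫⁻ x, F x ∂(Measure.pi μ) =
      ∫⁻ x, ∫⁻ ω, F (Function.update x i ω) ∂(μ i) ∂(Measure.pi μ) := by
  simp only [← lmarginal_singleton]
  refine lintegral_eq_of_lmarginal_eq {i} hF (hF.lmarginal μ) ?_
  funext x
  rw [lmarginal_singleton (μ := μ) (f := lmarginal μ {i} F)]
  simp only [lmarginal_update_of_mem μ (Finset.mem_singleton_self i)]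
  simp

/-- The total reward of a direct execution in the last `n` stages, if `φ i l a ω` is the reward and
the next level for data `ω` of stage `i`. -/
def dataRun {H k A : ℕ} {Ω : Type*} (φ : Fin H → Fin k → Fin A → Ω → ℝ × Fin (k + 1))
    (π : Policy H k A) (x : Fin H → Ω) : (n : ℕ) → n ≤ H → Fin (k + 1) → ℝ
  | 0, _, _ => 0
  | n + 1, h, c =>
    Fin.cases (motive := fun _ => ℝ) 0
      (fun l =>
        (φ (Fin.rev ⟨n, h⟩) l (π (Fin.rev ⟨n, h⟩) l) (x (Fin.rev ⟨n, h⟩))).1 +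
          dataRun φ π x n (Nat.le_of_succ_le h)
            (φ (Fin.rev ⟨n, h⟩) l (π (Fin.rev ⟨n, h⟩) l) (x (Fin.rev ⟨n, h⟩))).2) c

variable {H k A : ℕ} {Ω : Type*} {φ : Fin H → Fin k → Fin A → Ω → ℝ × Fin (k + 1)}

theorem dataRun_succ_zero (π : Policy H k A) (x : Fin H → Ω) (n : ℕ) (h : n + 1 ≤ H) :
    dataRun φ π x (n + 1) h 0 = 0 := by
  rw [dataRun, Fin.cases_zero]

theorem dataRun_succ_succ (π : Policy H k A) (x : Fin H → Ω) (n : ℕ) (h : n + 1 ≤ H)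
    (l : Fin k) : dataRun φ π x (n + 1) h l.succ =
      (φ (Fin.rev ⟨n, h⟩) l (π (Fin.rev ⟨n, h⟩) l) (x (Fin.rev ⟨n, h⟩))).1 +
          dataRun φ π x n (Nat.le_of_succ_le h)
            (φ (Fin.rev ⟨n, h⟩) l (π (Fin.rev ⟨n, h⟩) l) (x (Fin.rev ⟨n, h⟩))).2 := by
  rw [dataRun, Fin.cases_succ]

/-- The last `n` stages read only the coordinates from `H - n` on. -/
theorem dataRun_update (π : Policy H k A) (x : Fin H → Ω) (i : Fin H) (ω : Ω) (n : ℕ)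
    (h : n ≤ H) (hi : (i : ℕ) + n < H) (c : Fin (k + 1)) :
    dataRun φ π (Function.update x i ω) n h c = dataRun φ π x n h c := by
  induction n generalizing c with
  | zero => rfl
  | succ n ih =>
    cases c using Fin.cases with
    | zero => rw [dataRun_succ_zero, dataRun_succ_zero]
    | succ l =>
      have : Fin.rev ⟨n, h⟩ ≠ i := by
        rintro rfl
        rw [Fin.val_rev] at hi
        dsimp only at hi
        omega
      rw [dataRun_succ_succ, dataRun_succ_succ, Function.update_of_ne this,
        ih _ (by omega)]

variable [MeasurableSpace Ω]

theorem measurable_dataRun (hφ : ∀ i l a, Measurable (φ i l a)) (π : Policy H k A) (n : ℕ)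
    (h : n ≤ H) (c : Fin (k + 1)) : Measurable fun x : Fin H → Ω => dataRun φ π x n h c := by
  induction n generalizing c with
  | zero => exact measurable_const
  | succ n ih =>
    cases c using Fin.cases with
    | zero => simp only [dataRun_succ_zero]; exact measurable_const
    | succ l =>
      simp only [dataRun_succ_succ]
      have h1 := (hφ (Fin.rev ⟨n, h⟩) l (π (Fin.rev ⟨n, h⟩) l)).comp
        (measurable_pi_apply (X := fun _ : Fin H => Ω) (Fin.rev ⟨n, h⟩))
      have h2 : Measurable fun q : Fin (k + 1) × (Fin H → Ω) =>
          dataRun φ π q.2 n (Nat.le_of_succ_le h) q.1 :=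
        measurable_from_prod_countable_right fun c => ih _ c
      exact h1.fst.add (h2.comp (h1.snd.prodMk measurable_id))

namespace EpisodicMDP

variable {M : EpisodicMDP H k A} {μ : Fin H → Measure Ω} [∀ i, IsProbabilityMeasure (μ i)]

/-- The datum of the current stage can be resampled because the later stages do not read it;
Fubini's theorem then gives the recursion of `tailLaw`. -/
theorem tailLaw_eq_map_dataRun (hφ : ∀ i l a, Measurable (φ i l a))
    (hstep : ∀ i l a, M.step i l a = (μ i).map (φ i l a)) (π : Policy H k A) (n : ℕ) (h : n ≤ H)
    (c : Fin (k + 1)) :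
    M.tailLaw π n h c = (Measure.pi μ).map fun x => dataRun φ π x n h c := by
  induction n generalizing c with
  | zero => simp [tailLaw, dataRun]
  | succ n ih =>
    cases c using Fin.cases with
    | zero => simp [tailLaw_zero, dataRun_succ_zero]
    | succ l =>
      have hrun := fun n h c => measurable_dataRun hφ π n h c
      refine Measure.ext_of_lintegral _ fun f hf => ?_
      set i := Fin.rev ⟨n, h⟩ with hi
      set ψ := φ i l (π i l) with hψ
      have hψm : Measurable ψ := hφ _ _ _
      have hrun' : Measurable fun q : Fin (k + 1) × (Fin H → Ω) =>
          dataRun φ π q.2 n (Nat.le_of_succ_le h) q.1 :=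
        measurable_from_prod_countable_right fun c => hrun _ _ c
      rw [lintegral_tailLaw_succ _ _ _ _ _ hf, lintegral_map hf (hrun _ _ _),
        lintegral_pi_resample μ
          (F := fun x => f (dataRun φ π x (n + 1) h l.succ)) (hf.comp (hrun _ _ _)) i, hstep]
      have h1 : ∀ z : ℝ × Fin (k + 1),
          ∫⁻ x, f (z.1 + x) ∂(M.tailLaw π n (Nat.le_of_succ_le h) z.2) =
          ∫⁻ x, f (z.1 + dataRun φ π x n (Nat.le_of_succ_le h) z.2) ∂(Measure.pi μ) := fun z => by
        rw [ih]
        exact lintegral_map (hf.comp (measurable_const_add _)) (hrun _ _ _)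
      have h2 : ∀ (x : Fin H → Ω) (ω : Ω),
          dataRun φ π (Function.update x i ω) (n + 1) h l.succ =
          (ψ ω).1 + dataRun φ π x n (Nat.le_of_succ_le h) (ψ ω).2 := fun x ω => by
        rw [dataRun_succ_succ, ← hi, Function.update_self, dataRun_update]
        rw [hi, Fin.val_rev]
        dsimp only
        omega
      simp only [h1, h2]
      have hjoint : Measurable fun p : (ℝ × Fin (k + 1)) × (Fin H → Ω) =>
          f (p.1.1 + dataRun φ π p.2 n (Nat.le_of_succ_le h) p.1.2) :=
        hf.comp (measurable_fst.fst.add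
          (hrun'.comp (measurable_fst.snd.prodMk measurable_snd)))
      rw [lintegral_map hjoint.lintegral_prod_right' hψm, lintegral_lintegral_swap]
      exact (hjoint.comp ((hψm.comp measurable_fst).prodMk measurable_snd)).aemeasurable

/-- Problems with independent data are ordered MDPs. -/
theorem isNormalized_and_isOrdered_of_data {ord : Fin H → Fin k → LinearOrder (Fin A)}
    {run : Policy H k A → (Fin H → Ω) → ℝ}
    (hφ : ∀ i l a, Measurable (φ i l a))
    (hstep : ∀ i l a, M.step i l a = (μ i).map (φ i l a))
    (hrun : ∀ π x, run π x = dataRun φ π x H le_rfl (Fin.last k))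
    (hnonneg : ∀ i l a, ∀ᵐ ω ∂(μ i), 0 ≤ (φ i l a ω).1)
    (hle : ∀ i l a ω, (φ i l a ω).2 ≤ l.succ)
    (hstay : ∀ i l a b ω, (ord i l).lt a b → (φ i l a ω).2 = l.succ → (φ i l b ω).2 = l.succ)
    (hone : ∀ π, ∀ᵐ x ∂(Measure.pi μ), run π x ≤ 1) :
    M.IsNormalized ∧ M.IsOrdered ord ∧
      ∀ π, M.rewardLaw π = (Measure.pi μ).map fun x => run π x := by
  have hlaw : ∀ π, M.rewardLaw π = (Measure.pi μ).map fun x => run π x := fun π => by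
    simp only [hrun]
    exact tailLaw_eq_map_dataRun hφ hstep π H le_rfl _
  have hprob : ∀ i l a s, M.transProb i l a s = (μ i).real {ω | (φ i l a ω).2 = s} := by
    intro i l a s
    rw [transProb, hstep]
    exact map_measureReal_apply (hφ i l a) (measurable_snd (measurableSet_singleton s))
  refine ⟨⟨fun i l a => ?_, fun π => ?_⟩, ⟨fun i l a s hs => ?_, fun i l a b hab => ?_⟩, hlaw⟩
  · rw [hstep]
    exact (ae_map_iff (hφ i l a).aemeasurable (measurable_fst measurableSet_Ici)).2 (hnonneg i l a)
  · have hm : Measurable fun x => run π x := by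
      simp only [hrun]
      exact measurable_dataRun hφ π _ _ _
    rw [hlaw, ae_map_iff hm.aemeasurable measurableSet_Iic]
    exact hone π
  · have : {ω | (φ i l a ω).2 = s} = ∅ :=
      Set.eq_empty_of_forall_notMem fun ω hω => absurd hs (not_lt.2 (hω ▸ hle i l a ω))
    rw [hprob, this, measureReal_empty]
  · rw [hprob, hprob]
    -- Both actions are run on the same datum, so the events themselves are nested.
    exact measureReal_mono fun ω hω => hstay i l a b ω hab hω

end EpisodicMDP

/-! ### The three applications -/

/-- A larger threshold rejects every value that a smaller one rejects. -/
theorem prophetMDP_spec (H k A : ℕ) (μ : Fin H → Measure ℝ) [∀ i, IsProbabilityMeasure (μ i)]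
    (τ : Fin H → Fin A → ℝ) (hτ : ∀ i, Monotone (τ i)) (hμ : ∀ i, ∀ᵐ x ∂(μ i), 0 ≤ x)
    (hone : ∀ π : Policy H k A, ∀ᵐ x ∂(Measure.pi μ),
      prophetRun τ π x H le_rfl (Fin.last k) ≤ 1) :
    (prophetMDP k μ τ).IsNormalized ∧ (prophetMDP k μ τ).IsOrdered (indexOrder H k A) ∧
      ∀ π : Policy H k A, (prophetMDP k μ τ).rewardLaw π =
        (Measure.pi μ).map fun x => prophetRun τ π x H le_rfl (Fin.last k) := by
  refine EpisodicMDP.isNormalized_and_isOrdered_of_data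
    (φ := fun i l a x => if τ i a < x then (x, l.castSucc) else (0, l.succ))
    (run := fun π x => prophetRun τ π x H le_rfl (Fin.last k)) (fun i l a => ?_)
    (fun _ _ _ => rfl) (fun π x => ?_) (fun i l a => ?_) (fun i l a x => ?_)
    (fun i l a b x hab h => ?_) hone
  · exact Measurable.ite measurableSet_Ioi (measurable_id.prodMk measurable_const) measurable_const
  · have : ∀ n h c, prophetRun τ π x n h c = dataRun
        (fun i (l : Fin k) a x => if τ i a < x then (x, l.castSucc) else (0, l.succ)) π x n h c := by
      intro n
      induction n with
      | zero => exact fun _ _ => rfl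
      | succ n ih =>
        intro h c
        cases c using Fin.cases with
        | zero => rw [dataRun_succ_zero, prophetRun, Fin.cases_zero]
        | succ l =>
          rw [dataRun_succ_succ, prophetRun, Fin.cases_succ]
          split_ifs
          · rw [ih]
          · rw [ih, zero_add]
    exact this _ _ _
  · filter_upwards [hμ i] with x hx
    split_ifs
    · exact hx
    · exact le_rfl
  · split_ifs
    · exact Fin.castSucc_lt_succ.le
    · exact le_rfl
  · split_ifs at h with h1
    · exact absurd h Fin.castSucc_lt_succ.ne
    · rw [if_neg]
      exact fun h2 => h1 ((hτ i (show a < b from hab).le).trans_lt h2)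

/-- A customer who declines a price declines every higher one. -/
theorem pricingMDP_spec (H k A : ℕ) (μ : Fin H → Measure ℝ) [∀ i, IsProbabilityMeasure (μ i)]
    (p : Fin H → Fin A → ℝ) (hp : ∀ i, Monotone (p i)) (hp0 : ∀ i a, 0 ≤ p i a)
    (hone : ∀ π : Policy H k A, ∀ᵐ x ∂(Measure.pi μ),
      pricingRun p π x H le_rfl (Fin.last k) ≤ 1) :
    (pricingMDP k μ p).IsNormalized ∧ (pricingMDP k μ p).IsOrdered (indexOrder H k A) ∧
      ∀ π : Policy H k A, (pricingMDP k μ p).rewardLaw π =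
        (Measure.pi μ).map fun x => pricingRun p π x H le_rfl (Fin.last k) := by
  refine EpisodicMDP.isNormalized_and_isOrdered_of_data
    (φ := fun i l a x => if p i a ≤ x then (p i a, l.castSucc) else (0, l.succ))
    (run := fun π x => pricingRun p π x H le_rfl (Fin.last k)) (fun i l a => ?_)
    (fun _ _ _ => rfl) (fun π x => ?_) (fun i l a => ?_) (fun i l a x => ?_)
    (fun i l a b x hab h => ?_) hone
  · exact Measurable.ite measurableSet_Ici measurable_const measurable_const
  · have : ∀ n h c, pricingRun p π x n h c = dataRun
        (fun i (l : Fin k) a x => if p i a ≤ x then (p i a, l.castSucc) else (0, l.succ))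
        π x n h c := by
      intro n
      induction n with
      | zero => exact fun _ _ => rfl
      | succ n ih =>
        intro h c
        cases c using Fin.cases with
        | zero => rw [dataRun_succ_zero, pricingRun, Fin.cases_zero]
        | succ l =>
          rw [dataRun_succ_succ, pricingRun, Fin.cases_succ]
          split_ifs
          · rw [ih]
          · rw [ih, zero_add]
    exact this _ _ _
  · refine Filter.Eventually.of_forall fun x => ?_
    split_ifs
    · exact hp0 i a
    · exact le_rfl
  · split_ifs
    · exact Fin.castSucc_lt_succ.le
    · exact le_rfl
  · split_ifs at h with h1
    · exact absurd h Fin.castSucc_lt_succ.ne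
    · rw [if_neg]
      exact fun h2 => h1 ((hp i (show a < b from hab).le).trans h2)

/-- Rejection keeps the budget with certainty, so it is the maximal action whatever the joint law of
reward and cost. -/
theorem knapsackMDP_spec (H k : ℕ) (μ : Fin H → Measure (ℝ × ℕ))
    [∀ i, IsProbabilityMeasure (μ i)] (hμ : ∀ i, ∀ᵐ z ∂(μ i), 0 ≤ z.1)
    (hone : ∀ π : Policy H k 2, ∀ᵐ z ∂(Measure.pi μ),
      knapsackRun π z H le_rfl (Fin.last k) ≤ 1) :
    (knapsackMDP k μ).IsNormalized ∧ (knapsackMDP k μ).IsOrdered (indexOrder H k 2) ∧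
      ∀ π : Policy H k 2, (knapsackMDP k μ).rewardLaw π =
        (Measure.pi μ).map fun z => knapsackRun π z H le_rfl (Fin.last k) := by
  refine EpisodicMDP.isNormalized_and_isOrdered_of_data
    (φ := fun i l a z => if a = 0 then knapsackAccept l z else (0, l.succ))
    (run := fun π z => knapsackRun π z H le_rfl (Fin.last k)) (fun i l a => ?_)
    (fun i l a => ?_) (fun π x => ?_) (fun i l a => ?_) (fun i l a z => ?_)
    (fun i l a b z hab h => ?_) hone
  · split_ifs
    · exact measurable_knapsackAccept l
    · exact measurable_const
  · change (if a = 0 then (μ i).map (knapsackAccept l) else Measure.dirac (0, l.succ)) = _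
    split_ifs
    · rfl
    · rw [Measure.map_const, measure_univ, one_smul]
  · have : ∀ n h c, knapsackRun π x n h c = dataRun
        (fun _ (l : Fin k) (a : Fin 2) z => if a = 0 then knapsackAccept l z else (0, l.succ))
        π x n h c := by
      intro n
      induction n with
      | zero => exact fun _ _ => rfl
      | succ n ih =>
        intro h c
        cases c using Fin.cases with
        | zero => rw [dataRun_succ_zero, knapsackRun, Fin.cases_zero]
        | succ l =>
          rw [dataRun_succ_succ, knapsackRun, Fin.cases_succ]
          split_ifs
          · rw [ih]
          · rw [ih, zero_add]
    exact this _ _ _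
  · filter_upwards [hμ i] with z hz
    unfold knapsackAccept
    split_ifs
    · exact hz
    · exact le_rfl
    · exact le_rfl
  · unfold knapsackAccept
    split_ifs
    · rw [Fin.le_def, Fin.val_succ]
      exact Nat.sub_le _ _
    · exact Fin.zero_le _
    · exact le_rfl
  · have hb : b ≠ 0 := fun hb => by
      rw [hb] at hab
      exact absurd (show a < 0 from hab) (Fin.not_lt_zero a)
    rw [if_neg hb]

end

end BanditMDP

theorem mainTheorem2 :
    -- the regret bound for ordered MDPs
    (∃ K : ℝ, 0 < K ∧
      ∀ (H k A : ℕ) [NeZero A] (_hk : 1 ≤ k) (hkH : k ≤ H)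
        (ord : Fin H → Fin k → LinearOrder (Fin A)) (T : ℕ) (_hT : 2 ≤ T),
        BanditMDP.OnlineAlgorithm.IsMeasurable (BanditMDP.orderedAlgorithm hkH ord T) ∧
        ∀ M : BanditMDP.EpisodicMDP H k A, M.IsNormalized → M.IsOrdered ord →
          M.expectedRegret T (BanditMDP.orderedAlgorithm hkH ord T) ≤
            ENNReal.ofReal (K * ((2 * Real.exp 1 * (H : ℝ) ^ 2 * A / k) ^ k *
              √((k : ℝ) ^ 3 * H / A * T * Real.log T)))) ∧
    -- the `k`-item prophet inequality
    (∀ (H k A : ℕ) (μ : Fin H → MeasureTheory.Measure ℝ)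
        [∀ i, MeasureTheory.IsProbabilityMeasure (μ i)] (τ : Fin H → Fin A → ℝ),
        (∀ i, Monotone (τ i)) → (∀ i, ∀ᵐ x ∂(μ i), 0 ≤ x) →
        (∀ π : BanditMDP.Policy H k A, ∀ᵐ x ∂(MeasureTheory.Measure.pi μ),
          BanditMDP.prophetRun τ π x H le_rfl (Fin.last k) ≤ 1) →
        (BanditMDP.prophetMDP k μ τ).IsNormalized ∧
        (BanditMDP.prophetMDP k μ τ).IsOrdered (BanditMDP.indexOrder H k A) ∧
        ∀ π : BanditMDP.Policy H k A, (BanditMDP.prophetMDP k μ τ).rewardLaw π =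
          (MeasureTheory.Measure.pi μ).map
            fun x => BanditMDP.prophetRun τ π x H le_rfl (Fin.last k)) ∧
    -- sequential posted pricing
    (∀ (H k A : ℕ) (μ : Fin H → MeasureTheory.Measure ℝ)
        [∀ i, MeasureTheory.IsProbabilityMeasure (μ i)] (p : Fin H → Fin A → ℝ),
        (∀ i, Monotone (p i)) → (∀ i a, 0 ≤ p i a) →
        (∀ π : BanditMDP.Policy H k A, ∀ᵐ x ∂(MeasureTheory.Measure.pi μ),
          BanditMDP.pricingRun p π x H le_rfl (Fin.last k) ≤ 1) →
        (BanditMDP.pricingMDP k μ p).IsNormalized ∧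
        (BanditMDP.pricingMDP k μ p).IsOrdered (BanditMDP.indexOrder H k A) ∧
        ∀ π : BanditMDP.Policy H k A, (BanditMDP.pricingMDP k μ p).rewardLaw π =
          (MeasureTheory.Measure.pi μ).map
            fun x => BanditMDP.pricingRun p π x H le_rfl (Fin.last k)) ∧
    -- stochastic knapsack with a fixed item order
    (∀ (H k : ℕ) (μ : Fin H → MeasureTheory.Measure (ℝ × ℕ))
        [∀ i, MeasureTheory.IsProbabilityMeasure (μ i)],
        (∀ i, ∀ᵐ z ∂(μ i), 0 ≤ z.1) →
        (∀ π : BanditMDP.Policy H k 2, ∀ᵐ z ∂(MeasureTheory.Measure.pi μ),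
          BanditMDP.knapsackRun π z H le_rfl (Fin.last k) ≤ 1) →
        (BanditMDP.knapsackMDP k μ).IsNormalized ∧
        (BanditMDP.knapsackMDP k μ).IsOrdered (BanditMDP.indexOrder H k 2) ∧
        ∀ π : BanditMDP.Policy H k 2, (BanditMDP.knapsackMDP k μ).rewardLaw π =
          (MeasureTheory.Measure.pi μ).map
            fun z => BanditMDP.knapsackRun π z H le_rfl (Fin.last k)) := by
  exact ⟨⟨93, by norm_num, fun H k A _ hk hkH ord T hT =>
      ⟨BanditMDP.isMeasurable_orderedAlgorithm hkH ord T, fun _ hM hord =>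
        BanditMDP.EpisodicMDP.expectedRegret_orderedAlgorithm_le_ofReal hM hT hk hkH hord⟩⟩,
    BanditMDP.prophetMDP_spec, BanditMDP.pricingMDP_spec, BanditMDP.knapsackMDP_spec⟩
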